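/- Let $\mathcal M$ be a smooth (Hausdorff, real) Banach manifold and $G$ a finite-dimensional Lie group acting on $\mathcal M$ by a continuous action $G\times\mathcal M\to\mathcal M$ such that each $\phi_g\colon y\mapsto g\cdot y$ is a smooth diffeomorphism. Let $x\in\mathcal M$ be such that $\beta_x\colon G\to\mathcal M$, $\beta_x(g)=g\cdot x$, is differentiable, and assume that the isotropy group $G_x=\{g\in G: g\cdot x=x\}$ is compact. Let $\mathcal M$ be endowed with a connection, i.e., a smooth map $P\colon T(T\mathcal M)\to T\mathcal M$ that maps each $T_e(T\mathcal M)$, $e\in T_y\mathcal M$, linearly to $T_y\mathcal M$ and has, in each local trivialization $s$ of an atlas of trivializations of $\pi\colon T\mathcal M\to\mathcal M$, the form $P(\eta)=s(y)\big(\mathrm d\tilde s_e(\eta)\big)+\Gamma_y\big(\mathrm d\pi_e(\eta),e\big)$, where $\tilde s(e)=s(\pi(e))^{-1}e$ and $\Gamma$ is a smooth field of continuous bilinear maps. Assume that the connection is $G$-invariant, i.e., each $\phi_g$ is affine: $P\circ\mathrm d(\mathrm d\phi_g)=\mathrm d\phi_g\circ P$. Let $\exp_x$ be the exponential map of $P$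 at $x$: $\exp_x(v)=\pi(c(1))$, where $c$ is the integral curve with $c(0)=v$ of the geodesic field of $P$, the vector field on $T\mathcal M$ whose value at $u$ is the unique $\eta\in T_u(T\mathcal M)$ with $P(\eta)=0$ and $\mathrm d\pi_u(\eta)=u$; $\exp_x(v)$ is defined if $c$ is defined on an open interval containing $[0,1]$. A slice at $x$ is a smooth (embedded, split) submanifold $\mathcal S\subset\mathcal M$ containing $x$ such that 1. $T_x\mathcal S$ is a closed complement of the orbit tangent space: $T_x\mathcal M=\operatorname{Im}\big(\mathrm d\beta_x(1)\big)\oplus T_x\mathcal S$; 2. $G\cdot\mathcal S$ is a neighborhood of the orbit $G\cdot x$; 3. $\mathcal S$ is invariant under $G_x$. Then there exists a slice through $x$. More precisely, there is a closed subspace $W\subset T_x\mathcal M$, invariant under the isotropy representation $g\mapsto\mathrm d\phi_g(x)$ of $G_x$, with $T_x\mathcal M=\operatorname{Im}\big(\mathrm d\beta_x(1)\big)\oplus W$, such that every neighborhood of $0$ in $T_x\mathcal M$ contains an open neighborhood $U$ of $0$ for which $U\cap W$ is $G_x$-invariant, $\exp_x$ is defined on $U$ and maps it diffeomorphically onto an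 open subset of $\mathcal M$, and $\mathcal S=\exp_x(U\cap W)$ is a slice at $x$. -/

import Mathlib

open Set Filter Topology
open scoped Manifold ContDiff

noncomputable section

/-! ### Connections on a Banach manifold, affine maps, geodesics, exponential map -/

section Connection

variable (E : Type*) [NormedAddCommGroup E] [NormedSpace ℝ E]
  (M : Type*) [TopologicalSpace M] [ChartedSpace E M] [IsManifold 𝓘(ℝ, E) ∞ M]

/-- The principal part `s̃(e) = s(π e)⁻¹ e` of the local trivialization of `TM` induced by the
chart at `x₀`. It is meaningful over the domain of that chart. -/
def tangentCoord {E : Type*} [NormedAddCommGroup E] [NormedSpace ℝ E]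
    {M : Type*} [TopologicalSpace M] [ChartedSpace E M] [IsManifold 𝓘(ℝ, E) ∞ M]
    (x₀ : M) (e : TangentBundle 𝓘(ℝ, E) M) : E :=
  (trivializationAt E (TangentSpace 𝓘(ℝ, E) : M → Type _) x₀ e).2

/-- The differential `ds̃_e` of the principal part of a local trivialization. -/
def tangentCoordDeriv {E : Type*} [NormedAddCommGroup E] [NormedSpace ℝ E]
    {M : Type*} [TopologicalSpace M] [ChartedSpace E M] [IsManifold 𝓘(ℝ, E) ∞ M]
    (x₀ : M) (e : TangentBundle 𝓘(ℝ, E) M) : TangentSpace 𝓘(ℝ, E).tangent e →L[ℝ] E :=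
  mfderiv 𝓘(ℝ, E).tangent 𝓘(ℝ, E) (tangentCoord x₀) e

/-- The differential `dπ_e` of the bundle projection `π : TM → M`. -/
def projDeriv {E : Type*} [NormedAddCommGroup E] [NormedSpace ℝ E]
    {M : Type*} [TopologicalSpace M] [ChartedSpace E M] [IsManifold 𝓘(ℝ, E) ∞ M]
    (e : TangentBundle 𝓘(ℝ, E) M) :
    TangentSpace 𝓘(ℝ, E).tangent e →L[ℝ] TangentSpace 𝓘(ℝ, E) e.proj :=
  mfderiv 𝓘(ℝ, E).tangent 𝓘(ℝ, E) (fun u : TangentBundle 𝓘(ℝ, E) M ↦ u.proj) e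

/-- A connection on the tangent bundle of `M`: a smooth map `P : T(TM) → TM` mapping each
`T_e(TM)`, `e ∈ T_xM`, linearly to `T_xM`, and such that in each of the local trivializations of
`TM` given by the preferred charts of `M` (they form an atlas of trivializations)
`P η = s(ds̃(η)) + Γ_x(dπ(η), e)`, with `Γ` a smooth field of continuous bilinear maps.
Both sides of this identity are written in the trivialization, i.e. after applying `s̃`. -/
structure TangentConnection where
  /-- The restriction of `P` to the tangent space `T_e(TM)`. -/
  toFun : ∀ e : TangentBundle 𝓘(ℝ, E) M,
    TangentSpace 𝓘(ℝ, E).tangent e →L[ℝ] TangentSpace 𝓘(ℝ, E) e.proj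
  smooth : ContMDiff 𝓘(ℝ, E).tangent.tangent 𝓘(ℝ, E).tangent ∞
    (fun η : TangentBundle 𝓘(ℝ, E).tangent (TangentBundle 𝓘(ℝ, E) M) ↦
      (⟨η.proj.proj, toFun η.proj η.2⟩ : TangentBundle 𝓘(ℝ, E) M))
  local_form : ∀ x₀ : M, ∃ Γ : M → E →L[ℝ] E →L[ℝ] E,
    ContMDiffOn 𝓘(ℝ, E) 𝓘(ℝ, E →L[ℝ] E →L[ℝ] E) ∞ Γ (chartAt E x₀).source ∧
    ∀ e : TangentBundle 𝓘(ℝ, E) M, e.proj ∈ (chartAt E x₀).source →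
      ∀ η : TangentSpace 𝓘(ℝ, E).tangent e,
        tangentCoord x₀ ⟨e.proj, toFun e η⟩ = tangentCoordDeriv x₀ e η +
          Γ e.proj (tangentCoord x₀ ⟨e.proj, projDeriv e η⟩) (tangentCoord x₀ e)

variable {E M}

namespace TangentConnection

/-- The connection as a map `T(TM) → TM` of total spaces. -/
def totalMap (P : TangentConnection E M)
    (η : TangentBundle 𝓘(ℝ, E).tangent (TangentBundle 𝓘(ℝ, E) M)) : TangentBundle 𝓘(ℝ, E) M :=
  ⟨η.proj.proj, P.toFun η.proj η.2⟩

/-- A self-map `f` of `M` is affine if it is smooth and `P ∘ d(df) = df ∘ P`. -/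
def IsAffine (P : TangentConnection E M) (f : M → M) : Prop :=
  ContMDiff 𝓘(ℝ, E) 𝓘(ℝ, E) ∞ f ∧
    P.totalMap ∘ tangentMap 𝓘(ℝ, E).tangent 𝓘(ℝ, E).tangent (tangentMap 𝓘(ℝ, E) 𝓘(ℝ, E) f) =
      tangentMap 𝓘(ℝ, E) 𝓘(ℝ, E) f ∘ P.totalMap

/-- There is exactly one horizontal vector in `T_v(TM)` that projects onto `v`. -/
theorem existsUnique_geodesicVector (P : TangentConnection E M) (v : TangentBundle 𝓘(ℝ, E) M) :
    ∃! η : TangentSpace 𝓘(ℝ, E).tangent v, P.toFun v η = 0 ∧ projDeriv v η = v.2 := by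
  set s := trivializationAt E (TangentSpace 𝓘(ℝ, E) : M → Type _) v.proj with hs
  have hv : v.proj ∈ (chartAt E v.proj).source := mem_chart_source E v.proj
  have hvs : v ∈ s.source := FiberBundle.mem_trivializationAt_proj_source
  have hbase : v.proj ∈ s.baseSet := FiberBundle.mem_baseSet_trivializationAt' v.proj
  obtain ⟨Γ, -, hΓ⟩ := P.local_form v.proj
  have hsd : MDifferentiableAt 𝓘(ℝ, E).tangent (𝓘(ℝ, E).prod 𝓘(ℝ, E)) s v :=
    ((s.contMDiffOn (n := ∞) (IB := 𝓘(ℝ, E))).contMDiffAt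
      (s.open_source.mem_nhds hvs)).mdifferentiableAt (by simp)
  have hst : s v ∈ s.target := s.map_source hvs
  have hsi : MDifferentiableAt (𝓘(ℝ, E).prod 𝓘(ℝ, E)) 𝓘(ℝ, E).tangent
      s.toOpenPartialHomeomorph.symm (s v) :=
    ((s.contMDiffOn_symm (n := ∞) (IB := 𝓘(ℝ, E))).contMDiffAt
      (s.open_target.mem_nhds hst)).mdifferentiableAt (by simp)
  have hproj : MDifferentiableAt 𝓘(ℝ, E).tangent 𝓘(ℝ, E)
      (fun u : TangentBundle 𝓘(ℝ, E) M ↦ u.proj) v :=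
    (Bundle.contMDiff_proj (n := ∞) (TangentSpace 𝓘(ℝ, E) : M → Type _)).mdifferentiableAt
      (by simp)
  have hcoord : MDifferentiableAt 𝓘(ℝ, E).tangent 𝓘(ℝ, E) (tangentCoord v.proj) v :=
    mdifferentiableAt_snd.comp v hsd
  let L : TangentSpace 𝓘(ℝ, E).tangent v →L[ℝ] E × E :=
    (projDeriv v : TangentSpace 𝓘(ℝ, E).tangent v →L[ℝ] E).prod (tangentCoordDeriv v.proj v)
  have hL : HasMFDerivAt 𝓘(ℝ, E).tangent (𝓘(ℝ, E).prod 𝓘(ℝ, E)) s v L := by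
    refine (HasMFDerivAt.prodMk hproj.hasMFDerivAt hcoord.hasMFDerivAt).congr_of_eventuallyEq ?_
    filter_upwards [s.open_source.mem_nhds hvs] with u hu
    exact Prod.ext (s.coe_fst hu) rfl
  let R : E × E →L[ℝ] TangentSpace 𝓘(ℝ, E).tangent v :=
    mfderiv (𝓘(ℝ, E).prod 𝓘(ℝ, E)) 𝓘(ℝ, E).tangent s.toOpenPartialHomeomorph.symm (s v)
  have hinv : s.toOpenPartialHomeomorph.symm (s v) = v :=
    s.toOpenPartialHomeomorph.left_inv hvs
  have hR : HasMFDerivAt (𝓘(ℝ, E).prod 𝓘(ℝ, E)) 𝓘(ℝ, E).tangent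
      s.toOpenPartialHomeomorph.symm (s v) R := hsi.hasMFDerivAt
  have hRL : R.comp L = ContinuousLinearMap.id ℝ _ := by
    refine hasMFDerivAt_unique ((hR.comp v hL).congr_of_eventuallyEq ?_) (hasMFDerivAt_id v)
    filter_upwards [s.open_source.mem_nhds hvs] with u hu
    exact (s.toOpenPartialHomeomorph.left_inv hu).symm
  have hLR : L.comp R = ContinuousLinearMap.id ℝ _ := by
    have hL' : HasMFDerivAt 𝓘(ℝ, E).tangent (𝓘(ℝ, E).prod 𝓘(ℝ, E)) s
        (s.toOpenPartialHomeomorph.symm (s v)) L := by rw [hinv]; exact hL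
    refine hasMFDerivAt_unique ((hL'.comp (s v) hR).congr_of_eventuallyEq ?_)
      (hasMFDerivAt_id (s v))
    filter_upwards [s.open_target.mem_nhds hst] with u hu
    exact (s.toOpenPartialHomeomorph.right_inv hu).symm
  have hcoordP : ∀ w : TangentSpace 𝓘(ℝ, E) v.proj,
      tangentCoord v.proj ⟨v.proj, w⟩ = s.continuousLinearEquivAt ℝ v.proj hbase w :=
    fun w ↦ rfl
  have hzero : ∀ η, P.toFun v η = 0 ↔ tangentCoordDeriv v.proj v η +
      Γ v.proj (tangentCoord v.proj ⟨v.proj, projDeriv v η⟩) (tangentCoord v.proj v) = 0 := by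
    intro η
    rw [← hΓ v hv η, hcoordP, map_eq_zero_iff _ (ContinuousLinearEquiv.injective _)]
  let q : E × E :=
    (v.2, - Γ v.proj (tangentCoord v.proj ⟨v.proj, v.2⟩) (tangentCoord v.proj v))
  have hkey : ∀ η, (P.toFun v η = 0 ∧ projDeriv v η = v.2) ↔ L η = q := by
    intro η
    rw [hzero]
    constructor
    · rintro ⟨h1, h2⟩
      refine Prod.ext h2 ?_
      rw [h2] at h1
      exact eq_neg_of_add_eq_zero_left h1
    · intro h
      have h1 : projDeriv v η = v.2 := congrArg Prod.fst h
      have h2 : tangentCoordDeriv v.proj v η =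
        - Γ v.proj (tangentCoord v.proj ⟨v.proj, v.2⟩) (tangentCoord v.proj v) :=
        congrArg Prod.snd h
      rw [h1, h2]
      exact ⟨neg_add_cancel _, rfl⟩
  refine ⟨R q, (hkey _).2 (DFunLike.congr_fun hLR q), fun η hη ↦ ?_⟩
  rw [← (hkey η).1 hη]
  exact (DFunLike.congr_fun hRL η).symm

/-- The geodesic field `X(P)` on `TM`: its value at `v` is the unique horizontal vector in
`T_v(TM)` that projects onto `v`. -/
def geodesicField (P : TangentConnection E M) (v : TangentBundle 𝓘(ℝ, E) M) :
    TangentSpace 𝓘(ℝ, E).tangent v :=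
  (P.existsUnique_geodesicVector v).choose

/-- `c` is an integral curve of the geodesic field on an open interval containing `[0, 1]`, with
initial value `c 0 = v`; its projection to `M` is then a geodesic with initial velocity `v`. -/
def IsGeodesicLift (P : TangentConnection E M) (v : TangentBundle 𝓘(ℝ, E) M)
    (c : ℝ → TangentBundle 𝓘(ℝ, E) M) : Prop :=
  c 0 = v ∧ ∃ a b : ℝ, a < 0 ∧ 1 < b ∧ IsMIntegralCurveOn c P.geodesicField (Ioo a b)

/-- The domain of the exponential map. -/
def expDomain (P : TangentConnection E M) : Set (TangentBundle 𝓘(ℝ, E) M) :=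
  {v | ∃ c, P.IsGeodesicLift v c}

open Classical in
/-- The exponential map: the value at time `1` of the geodesic with initial velocity `v`. Outside
its domain it is given the irrelevant value `π v`. -/
def exp (P : TangentConnection E M) (v : TangentBundle 𝓘(ℝ, E) M) : M :=
  if h : ∃ c, P.IsGeodesicLift v c then (h.choose 1).proj else v.proj

/-- The exponential map `exp_x` at the point `x`. -/
def expAt (P : TangentConnection E M) (x : M) (v : TangentSpace 𝓘(ℝ, E) x) : M :=
  P.exp ⟨x, v⟩

end TangentConnection

end Connection

/-! ### Submanifolds and slices -/

section Slice

variable {E : Type*} [NormedAddCommGroup E] [NormedSpace ℝ E]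
  {M : Type*} [TopologicalSpace M] [ChartedSpace E M]

/-- `S` is a smooth (embedded, split) submanifold of `M`: near each of its points there is a
smooth chart of `M` mapping `S` onto the trace of a closed complemented linear subspace. -/
def IsSmoothSubmanifold (E : Type*) [NormedAddCommGroup E] [NormedSpace ℝ E]
    {M : Type*} [TopologicalSpace M] [ChartedSpace E M] (S : Set M) : Prop :=
  ∀ p ∈ S, ∃ φ ∈ IsManifold.maximalAtlas 𝓘(ℝ, E) ∞ M, ∃ F : Submodule ℝ E,
    p ∈ φ.source ∧ F.ClosedComplemented ∧ φ '' (S ∩ φ.source) = φ.target ∩ (F : Set E)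

/-- The tangent vectors at `p` to `S ⊆ M`: the velocities at `p` of smooth curves of `M`
that stay in `S`. -/
def tangentVectors (S : Set M) (p : M) : Set (TangentSpace 𝓘(ℝ, E) p) :=
  {v | ∃ γ : ℝ → M, (∀ᶠ t in 𝓝 (0 : ℝ), γ t ∈ S) ∧ ContMDiffAt 𝓘(ℝ, ℝ) 𝓘(ℝ, E) ∞ γ 0 ∧
    ∃ h : γ 0 = p, (h ▸ mfderiv 𝓘(ℝ, ℝ) 𝓘(ℝ, E) γ 0 (1 : ℝ) : TangentSpace 𝓘(ℝ, E) p) = v}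

variable {EG : Type*} [NormedAddCommGroup EG] [NormedSpace ℝ EG]
  {G : Type*} [TopologicalSpace G] [ChartedSpace EG G] [Group G] [MulAction G M]

/-- The tangent space to the orbit of `x`, i.e. the image of `dβ_x(1)`, where `β_x(g) = g • x`.
(`T_{1 • x}M` and `T_xM` are the same since `1 • x = x`.) -/
def orbitTangentSpace (EG : Type*) [NormedAddCommGroup EG] [NormedSpace ℝ EG]
    (G : Type*) [TopologicalSpace G] [ChartedSpace EG G] [Group G] [MulAction G M] (x : M) :
    Submodule ℝ (TangentSpace 𝓘(ℝ, E) x) :=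
  LinearMap.range
    (mfderiv 𝓘(ℝ, EG) 𝓘(ℝ, E) (fun g : G ↦ g • x) 1 :
      TangentSpace 𝓘(ℝ, EG) (1 : G) →L[ℝ] TangentSpace 𝓘(ℝ, E) x).toLinearMap

/-- The isotropy representation `g ↦ dφ_g(x)` of `G_x` on `T_xM`, where `φ_g(y) = g • y`.
(`T_{g • x}M` and `T_xM` are the same since `g • x = x`.) -/
def isotropyRep (x : M) (g : MulAction.stabilizer G x) :
    TangentSpace 𝓘(ℝ, E) x →L[ℝ] TangentSpace 𝓘(ℝ, E) x :=
  mfderiv 𝓘(ℝ, E) 𝓘(ℝ, E) (fun y : M ↦ (g : G) • y) x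

/-- `S` is a slice at `x` for the action of `G` on `M`. -/
structure IsSlice (EG : Type*) [NormedAddCommGroup EG] [NormedSpace ℝ EG]
    (E : Type*) [NormedAddCommGroup E] [NormedSpace ℝ E]
    (G : Type*) [TopologicalSpace G] [ChartedSpace EG G] [Group G]
    {M : Type*} [TopologicalSpace M] [ChartedSpace E M] [MulAction G M]
    (x : M) (S : Set M) : Prop where
  isSmoothSubmanifold : IsSmoothSubmanifold E S
  mem : x ∈ S
  /-- `T_xS` is a closed complement to the image of `dβ_x(1)`. -/
  isCompl : ∃ T : Submodule ℝ (TangentSpace 𝓘(ℝ, E) x),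
    (T : Set (TangentSpace 𝓘(ℝ, E) x)) = tangentVectors S x ∧
    IsClosed (T : Set (TangentSpace 𝓘(ℝ, E) x)) ∧ IsCompl (orbitTangentSpace EG G x) T
  /-- `G · S` is a neighborhood of the orbit `G · x`. -/
  mem_nhdsSet : (⋃ g : G, (fun y : M ↦ g • y) '' S) ∈ 𝓝ˢ (MulAction.orbit G x)
  /-- `S` is invariant under the isotropy group `G_x`. -/
  invariant : ∀ g ∈ MulAction.stabilizer G x, ∀ y ∈ S, g • y ∈ S

end Slice

end

/-! Affine maps carry geodesics to geodesics, so $\exp_x$ intertwines the linear isotropy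
representation of $G_x$ with the action on $\mathcal M$ (`expAt_isotropyRep`). It is also a local
diffeomorphism at $0$ with differential the identity (`exists_partialDiffeomorph_expAt`). Near $x$
the action of $G_x$ is therefore linear in exponential coordinates, and the slice can be sought in
$T_x\mathcal M$. The orbit tangent space $T$ is finite-dimensional and $G_x$-invariant; averaging a
continuous projection onto $T$ over $G_x$ gives an equivariant projection $p$
(`exists_equivariant_projection`), and $W=\ker p$. Then $\mathcal S=\exp_x(U\cap W)$ for a small
invariant neighborhood $U$ of $0$.

Averaging needs joint continuity of the isotropy representation, while the action is only assumed
continuous in both variables and smooth for each fixed $g$. Near $0$ the representation is the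
action read in exponential coordinates, so continuity of the action suffices
(`continuous_isotropyRep`).

The delicate point is that $G\cdot\mathcal S$ is a neighborhood of $x$. For $y$ near $x$ one needs a
zero of $\xi\mapsto p(\exp_x^{-1}(\gamma(\xi)\cdot y))$, where $\gamma$ parametrizes elements of $G$
near $1$ by $T$. For $y=x$ this map has derivative the identity at $0$, but for other $y$ it is
merely continuous, so the implicit function theorem is not applicable. It is uniformly close to the
map for $x$ on a small closed ball, and Brouwer's theorem supplies a zero
(`eventually_exists_zero`).

Two analytic ingredients are proved from scratch: Brouwer's theorem, by a volume computation, and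
the smoothness of $\exp_x$, by the inverse function theorem in a space of continuous curves. -/

noncomputable section

/-! ### Brouwer's fixed point theorem -/

section Brouwer

open MeasureTheory Metric

/-- `det (1 + s • A)` is a polynomial in `s` of degree at most `dim V`, hence determined by `dim V +
1` nodes. The weights do not depend on `A`, so the identity can be integrated termwise. -/
theorem det_one_add_eq_sum_lagrange {V : Type*} [AddCommGroup V] [Module ℝ V]
    [FiniteDimensional ℝ V] (t : Fin (Module.finrank ℝ V + 1) → ℝ) (ht : Function.Injective t)
    (A : V →ₗ[ℝ] V) :
    LinearMap.det (1 + A) = ∑ i, LinearMap.det (1 + t i • A) *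
      (Lagrange.basis Finset.univ t i).eval 1 := by
  classical
  let b := Module.finBasis ℝ V
  set B := LinearMap.toMatrix b b A with hB
  let p : Polynomial ℝ := Matrix.det ((Polynomial.X : Polynomial ℝ) • B.map Polynomial.C +
    (1 : Matrix _ _ ℝ).map Polynomial.C)
  have hp : ∀ s : ℝ, p.eval s = LinearMap.det (1 + s • A) := by
    intro s
    rw [← LinearMap.det_toMatrix b, map_add, map_smul, LinearMap.toMatrix_one, ← hB]
    simp only [p]
    rw [← Polynomial.coe_evalRingHom, RingHom.map_det]
    congr 1
    ext i j
    simp [Matrix.one_apply, apply_ite, add_comm]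
    ring
  have hdeg : p.degree < (Finset.univ : Finset (Fin (Module.finrank ℝ V + 1))).card := by
    refine lt_of_le_of_lt Polynomial.degree_le_natDegree ?_
    have := Polynomial.natDegree_det_X_add_C_le B 1
    simp only [Fintype.card_fin] at this
    simp only [Finset.card_univ, Fintype.card_fin]
    exact_mod_cast Nat.lt_succ_of_le this
  have h1 := Lagrange.eq_interpolate (f := p) (s := Finset.univ) (v := t) ht.injOn hdeg
  have h2 := congrArg (Polynomial.eval 1) h1
  rw [hp 1, one_smul, Lagrange.interpolate_apply, Polynomial.eval_finsetSum] at h2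
  rw [h2]
  simp [hp]

variable {V : Type*} [NormedAddCommGroup V] [InnerProductSpace ℝ V] [FiniteDimensional ℝ V]

/-- Adding a strict contraction to the identity gives a homeomorphism of `V`. It fixes every point
outside the ball, so it must permute the ball. -/
theorem image_ball_add_smul_of_lipschitz {h : V → V} {C : NNReal} (hC : LipschitzWith C h)
    (h0 : ∀ x, 1 ≤ ‖x‖ → h x = 0) {t : ℝ} (ht0 : 0 < t) (ht : t * C < 1) :
    (fun x ↦ x + t • h x) '' ball 0 1 = ball 0 1 ∧
      Function.Injective (fun x ↦ x + t • h x) := by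
  have hA : ApproximatesLinearOn (fun x ↦ x + t • h x)
      ((ContinuousLinearEquiv.refl ℝ V : V ≃L[ℝ] V) : V →L[ℝ] V) univ (t.toNNReal * C) := by
    intro x _ y _
    have : x + t • h x - (y + t • h y) -
        ((ContinuousLinearEquiv.refl ℝ V : V ≃L[ℝ] V) : V →L[ℝ] V) (x - y) =
        t • (h x - h y) := by
      simp [smul_sub]; abel
    rw [this, norm_smul, Real.norm_of_nonneg ht0.le]
    rw [NNReal.coe_mul, Real.coe_toNNReal t ht0.le]
    have := hC.dist_le_mul x y
    rw [dist_eq_norm, dist_eq_norm] at this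
    rw [mul_assoc]
    exact mul_le_mul_of_nonneg_left this ht0.le
  have hcond : Subsingleton V ∨ t.toNNReal * C <
      ‖((ContinuousLinearEquiv.refl ℝ V).symm : V →L[ℝ] V)‖₊⁻¹ := by
    rcases subsingleton_or_nontrivial V with hV | hV
    · exact Or.inl hV
    · right
      have : ‖((ContinuousLinearEquiv.refl ℝ V).symm : V →L[ℝ] V)‖₊ = 1 := by
        ext
        simp
      rw [this, inv_one, ← NNReal.coe_lt_coe, NNReal.coe_mul, Real.coe_toNNReal t ht0.le]
      exact ht
  have hbij : Function.Bijective (fun x ↦ x + t • h x) := (hA.toHomeomorph _ hcond).bijective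
  refine ⟨?_, hbij.1⟩
  have hout : ∀ x ∈ (ball (0 : V) 1)ᶜ, x + t • h x = x := by
    intro x hx
    rw [h0 x (by simpa using hx)]; simp
  have : (fun x ↦ x + t • h x) '' (ball (0 : V) 1)ᶜ = (ball (0 : V) 1)ᶜ := by
    rw [image_congr hout, image_id']
  rw [image_compl_eq hbij, compl_inj_iff] at this
  exact this

/-- For small `t > 0` the change of variables formula gives the volume as the integral of `det (1 +
t • Dh)`. That integral is polynomial in `t`, so it keeps this value at `t = 1`. -/
theorem integral_det_one_add_fderiv [MeasurableSpace V] [BorelSpace V] {h : V → V}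
    {C : NNReal} (hC : LipschitzWith C h)
    (h0 : ∀ x, 1 ≤ ‖x‖ → h x = 0) (hd : ∀ x ∈ ball (0 : V) 1, DifferentiableAt ℝ h x) :
    ∫ x in ball (0 : V) 1, (1 + fderiv ℝ h x).det = (volume : Measure V).real (ball 0 1) := by
  have hdet : Continuous (fun A : V →L[ℝ] V ↦ A.det) := ContinuousLinearMap.continuous_det
  -- Positivity removes the absolute value of the Jacobian for small `t`.
  obtain ⟨ε, hε, hpos⟩ : ∃ ε > 0, ∀ A : V →L[ℝ] V, ‖A‖ < ε → 0 < (1 + A).det := by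
    have : ∀ᶠ A : V →L[ℝ] V in 𝓝 0, 0 < (1 + A).det := by
      refine (hdet.comp (continuous_const_add (1 : V →L[ℝ] V))).tendsto 0 |>.eventually
        (lt_mem_nhds ?_)
      simp [ContinuousLinearMap.det]
    obtain ⟨ε, hε, H⟩ := Metric.eventually_nhds_iff.1 this
    exact ⟨ε, hε, fun A hA ↦ H (by simpa using hA)⟩
  have hbound : ∀ x, ‖fderiv ℝ h x‖ ≤ C := fun x ↦ norm_fderiv_le_of_lipschitz ℝ hC
  have hsmall : ∀ t : ℝ, 0 < t → t * (C + 1) < min 1 ε →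
      ∫ x in ball (0 : V) 1, (1 + t • fderiv ℝ h x).det = (volume : Measure V).real (ball 0 1) := by
    intro t ht htC
    have htC1 : t * C < min 1 ε := by nlinarith
    obtain ⟨him, hinj⟩ := image_ball_add_smul_of_lipschitz hC h0 ht (lt_of_lt_of_le htC1
      (min_le_left _ _))
    have hder : ∀ x ∈ ball (0 : V) 1, HasFDerivWithinAt (fun x ↦ x + t • h x)
        (1 + t • fderiv ℝ h x) (ball 0 1) x := fun x hx ↦
      ((hasFDerivAt_id x).add ((hd x hx).hasFDerivAt.const_smul t)).hasFDerivWithinAt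
    have key := integral_image_eq_integral_abs_det_fderiv_smul volume measurableSet_ball hder
      hinj.injOn (fun _ ↦ (1 : ℝ))
    rw [him] at key
    simp only [smul_eq_mul, mul_one, integral_const, MeasurableSet.univ, measureReal_restrict_apply,
      univ_inter] at key
    rw [key]
    refine setIntegral_congr_fun measurableSet_ball fun x _ ↦ ?_
    refine (abs_of_pos (hpos _ ?_)).symm
    rw [norm_smul, Real.norm_of_nonneg ht.le]
    calc t * ‖fderiv ℝ h x‖ ≤ t * C := mul_le_mul_of_nonneg_left (hbound x) ht.le
      _ < ε := lt_of_lt_of_le htC1 (min_le_right _ _)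
  set d := Module.finrank ℝ V
  -- The nodes are `a * (i + 1)` with `i ≤ d`; the factor `d + 2` keeps even the last one in the
  -- range of `hsmall`, and `C + 1` avoids division by zero.
  set a : ℝ := min 1 ε / (C + 1) / (d + 2) with ha
  have hapos : 0 < a := by positivity
  let t : Fin (d + 1) → ℝ := fun i ↦ a * ((i : ℕ) + 1)
  have htinj : Function.Injective t := by
    intro i j hij
    have := mul_left_cancel₀ hapos.ne' hij
    exact Fin.ext (by exact_mod_cast add_right_cancel this)
  have htsmall : ∀ i, 0 < t i ∧ t i * (C + 1) < min 1 ε := by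
    intro i
    refine ⟨by positivity, ?_⟩
    have hi : ((i : ℕ) : ℝ) + 1 < d + 2 := by
      have := i.2
      have : ((i : ℕ) : ℝ) < d + 1 := by exact_mod_cast this
      linarith
    calc t i * (C + 1) = min 1 ε * ((((i : ℕ) : ℝ) + 1) / (d + 2)) := by
          simp only [t, ha]; field_simp
      _ < min 1 ε * 1 := by
          apply mul_lt_mul_of_pos_left _ (by positivity)
          rw [div_lt_one (by positivity)]; exact hi
      _ = _ := mul_one _
  have hint : ∀ i, Integrable (fun x ↦ (1 + t i • fderiv ℝ h x).det)
      (volume.restrict (ball (0 : V) 1)) := by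
    intro i
    have hm : Measurable (fun x ↦ (1 + t i • fderiv ℝ h x).det) :=
      (hdet.comp ((continuous_const_add (1 : V →L[ℝ] V)).comp
        (continuous_const_smul (t i)))).measurable.comp (measurable_fderiv ℝ h)
    obtain ⟨K, hK⟩ := (isCompact_closedBall (0 : V →L[ℝ] V) C).exists_bound_of_continuousOn
      (hdet.comp ((continuous_const_add (1 : V →L[ℝ] V)).comp
        (continuous_const_smul (t i)))).continuousOn
    have : IsFiniteMeasure (volume.restrict (ball (0 : V) 1)) :=
      ⟨by simpa using measure_ball_lt_top⟩
    refine Integrable.of_bound hm.aestronglyMeasurable K (Eventually.of_forall fun x ↦ ?_)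
    exact hK _ (by simpa using hbound x)
  have hsum : ∀ x, (1 + fderiv ℝ h x).det = ∑ i, (1 + t i • fderiv ℝ h x).det *
      (Lagrange.basis Finset.univ t i).eval 1 := fun x ↦
    det_one_add_eq_sum_lagrange t htinj (fderiv ℝ h x : V →ₗ[ℝ] V)
  simp_rw [hsum]
  rw [integral_finsetSum _ (fun i _ ↦ (hint i).mul_const _)]
  simp_rw [integral_mul_const, fun i ↦ hsmall (t i) (htsmall i).1 (htsmall i).2]
  rw [← Finset.mul_sum, ← Polynomial.eval_finsetSum, Lagrange.sum_basis htinj.injOn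
    Finset.univ_nonempty]
  simp

/-- Without a fixed point, following the ray from `f x` through `x` retracts the ball onto the
sphere by a map `x + g x` with `g = 0` on the sphere. Its Jacobian vanishes, yet
`integral_det_one_add_fderiv` makes the integral of the Jacobian the volume of the ball. -/
theorem exists_fixedPoint_of_contDiff {f : V → V} (hf : ContDiff ℝ 1 f)
    (hmaps : ∀ x, ‖x‖ ≤ 1 → ‖f x‖ ≤ 1) : ∃ x, ‖x‖ ≤ 1 ∧ f x = x := by
  borelize V
  by_contra! hne
  let u : V → V := fun x ↦ x - f x
  have hu : ContDiff ℝ 1 u := contDiff_id.sub hf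
  -- A quarter of the discriminant of the equation `‖x + λ • u x‖ ^ 2 = 1` in `λ`; `lam` below is
  -- its larger root. Strict positivity of `D` on the closed ball keeps the square root
  -- differentiable up to the boundary.
  let D : V → ℝ := fun x ↦ inner ℝ x (u x) ^ 2 + ‖u x‖ ^ 2 * (1 - ‖x‖ ^ 2)
  have hinner : ContDiff ℝ 1 (fun x ↦ inner ℝ x (u x)) := contDiff_id.inner ℝ hu
  have hD : ContDiff ℝ 1 D :=
    (hinner.pow 2).add ((hu.norm_sq ℝ).mul (contDiff_const.sub (contDiff_id.norm_sq ℝ)))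
  have hupos : ∀ x, ‖x‖ ≤ 1 → 0 < ‖u x‖ := fun x hx ↦
    norm_pos_iff.2 (sub_ne_zero.2 (hne x hx).symm)
  have hsphere : ∀ x, ‖x‖ = 1 → 0 < inner ℝ x (u x) := by
    intro x hx
    have h1 : inner ℝ x (u x) = 1 - inner ℝ x (f x) := by
      simp [u, inner_sub_right, hx]
    have h2 := hmaps x hx.le
    have h3 : ‖u x‖ ^ 2 = 1 - 2 * inner ℝ x (f x) + ‖f x‖ ^ 2 := by
      simp only [u]; rw [norm_sub_sq_real, hx]; ring
    have h4 := hupos x hx.le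
    have : 0 < ‖u x‖ ^ 2 := by positivity
    nlinarith [norm_nonneg (f x)]
  have hDpos : ∀ x, ‖x‖ ≤ 1 → 0 < D x := by
    intro x hx
    rcases hx.lt_or_eq with h | h
    · have := hupos x hx
      have h' : 0 < 1 - ‖x‖ ^ 2 := by nlinarith [norm_nonneg x]
      have : 0 < ‖u x‖ ^ 2 * (1 - ‖x‖ ^ 2) := by positivity
      simp only [D]; positivity
    · have := hsphere x h
      simp only [D, h]
      have : 0 < inner ℝ x (u x) ^ 2 := by positivity
      simpa using this
  let lam : V → ℝ := fun x ↦ (-inner ℝ x (u x) + √(D x)) / ‖u x‖ ^ 2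
  let g : V → V := fun x ↦ lam x • u x
  have hg : ∀ x, ‖x‖ ≤ 1 → ContDiffAt ℝ 1 g x := by
    intro x hx
    have h1 := (hupos x hx).ne'
    refine ContDiffAt.smul (ContDiffAt.div ?_ (hu.norm_sq ℝ).contDiffAt (by positivity))
      hu.contDiffAt
    exact hinner.contDiffAt.neg.add (hD.contDiffAt.sqrt (hDpos x hx).ne')
  have hret : ∀ x, ‖x‖ ≤ 1 → ‖x + g x‖ = 1 := by
    intro x hx
    have h1 := (hupos x hx).ne'
    have h2 := Real.sq_sqrt (hDpos x hx).le
    have h3 : ‖x + g x‖ ^ 2 = ‖x‖ ^ 2 + 2 * lam x * inner ℝ x (u x) + lam x ^ 2 * ‖u x‖ ^ 2 := by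
      simp only [g]
      rw [norm_add_sq_real, inner_smul_right, norm_smul, mul_pow, Real.norm_eq_abs, sq_abs]; ring
    have h5 : lam x * ‖u x‖ ^ 2 = -inner ℝ x (u x) + √(D x) := by
      simp only [lam]; field_simp
    have h6 : ‖u x‖ ^ 2 * (‖x + g x‖ ^ 2 - 1) = 0 := by
      rw [h3]
      have : ‖u x‖ ^ 2 * (‖x‖ ^ 2 + 2 * lam x * inner ℝ x (u x) + lam x ^ 2 * ‖u x‖ ^ 2 - 1) =
        (lam x * ‖u x‖ ^ 2) ^ 2 + 2 * (lam x * ‖u x‖ ^ 2) * inner ℝ x (u x) -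
          ‖u x‖ ^ 2 * (1 - ‖x‖ ^ 2) := by ring
      rw [this, h5]
      have h7 : √(D x) ^ 2 = inner ℝ x (u x) ^ 2 + ‖u x‖ ^ 2 * (1 - ‖x‖ ^ 2) := h2
      linear_combination h7
    have h7 : ‖x + g x‖ ^ 2 = 1 := by
      rcases mul_eq_zero.1 h6 with h | h
      · exact absurd h (by positivity)
      · linarith
    nlinarith [norm_nonneg (x + g x)]
  have hgsphere : ∀ x, ‖x‖ = 1 → g x = 0 := by
    intro x hx
    have : D x = inner ℝ x (u x) ^ 2 := by simp [D, hx]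
    simp [g, lam, this, Real.sqrt_sq (hsphere x hx).le]
  obtain ⟨K, hK⟩ := (isCompact_closedBall (0 : V) 1).exists_bound_of_continuousOn
    (f := fderiv ℝ g) (fun x hx ↦ ((hg x (by simpa using hx)).fderiv_right
      (m := 0) (by simp)).continuousAt.continuousWithinAt)
  have hlip : LipschitzOnWith K.toNNReal g (closedBall 0 1) :=
    (convex_closedBall (0 : V) 1).lipschitzOnWith_of_nnnorm_fderiv_le
      (fun x hx ↦ (hg x (by simpa using hx)).differentiableAt (by simp))
      (fun x hx ↦ by
        rw [← NNReal.coe_le_coe]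
        exact (hK x hx).trans (Real.le_coe_toNNReal K))
  let h : V → V := (closedBall (0 : V) 1).indicator g
  have hin : ∀ x, ‖x‖ ≤ 1 → h x = g x := fun x hx ↦ indicator_of_mem (by simpa using hx) _
  have hzero : ∀ x, 1 ≤ ‖x‖ → h x = 0 := by
    intro x hx
    rcases hx.eq_or_lt with hx | hx
    · rw [hin x hx.symm.le, hgsphere x hx.symm]
    · exact indicator_of_notMem (by simpa using hx) _
  -- The segment from `x` to `y` meets the unit sphere, where `g` vanishes, so the Lipschitz
  -- estimate inside the ball is enough.
  have hcross : ∀ x y, ‖x‖ ≤ 1 → 1 < ‖y‖ → dist (h x) (h y) ≤ K.toNNReal * dist x y := by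
    intro x y hx hy
    obtain ⟨z, hz, hz1⟩ : ∃ z ∈ segment ℝ x y, ‖z‖ = 1 := by
      have := (convex_segment x y).isPreconnected.intermediate_value
        (left_mem_segment ℝ x y) (right_mem_segment ℝ x y) continuous_norm.continuousOn
      exact this ⟨hx, hy.le⟩
    have h1 := hlip.dist_le_mul x (by simpa using hx) z (by simpa using hz1.le)
    rw [hgsphere z hz1] at h1
    rw [hzero y hy.le, hin x hx]
    refine h1.trans (mul_le_mul_of_nonneg_left ?_ (by positivity))
    have := dist_add_dist_of_mem_segment hz
    linarith [dist_nonneg (x := z) (y := y)]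
  have hLip : LipschitzWith K.toNNReal h := by
    refine LipschitzWith.of_dist_le_mul fun x y ↦ ?_
    rcases le_or_gt ‖x‖ 1 with hx | hx <;> rcases le_or_gt ‖y‖ 1 with hy | hy
    · rw [hin x hx, hin y hy]
      exact hlip.dist_le_mul x (by simpa using hx) y (by simpa using hy)
    · exact hcross x y hx hy
    · rw [dist_comm (h x), dist_comm x]
      exact hcross y x hy hx
    · rw [hzero x hx.le, hzero y hy.le, dist_self]; positivity
  have hev : ∀ x ∈ ball (0 : V) 1, h =ᶠ[𝓝 x] g := by
    intro x hx
    filter_upwards [isOpen_ball.mem_nhds hx] with y hy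
    exact hin y (by simpa using (mem_ball.1 hy).le)
  have hgd : ∀ x ∈ ball (0 : V) 1, DifferentiableAt ℝ g x := fun x hx ↦
    (hg x (by simpa using (mem_ball.1 hx).le)).differentiableAt (by simp)
  have hfd : ∀ x ∈ ball (0 : V) 1, DifferentiableAt ℝ h x := fun x hx ↦
    (hgd x hx).congr_of_eventuallyEq (hev x hx)
  have key := integral_det_one_add_fderiv hLip hzero hfd
  -- Differentiating `‖y + g y‖ ^ 2 = 1` shows that the range of the derivative is orthogonal to `x
  -- + g x`. Were the derivative surjective, it would attain this unit vector.
  have hdet0 : ∀ x ∈ ball (0 : V) 1, (1 + fderiv ℝ h x).det = 0 := by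
    intro x hx
    have hxn : ‖x‖ ≤ 1 := by simpa using (mem_ball.1 hx).le
    rw [(hev x hx).fderiv_eq]
    by_contra hdet
    have hr : HasFDerivAt (fun y ↦ y + g y) (1 + fderiv ℝ g x) x :=
      (hasFDerivAt_id x).add (hgd x hx).hasFDerivAt
    have h1 : HasFDerivAt (fun y ↦ inner ℝ (y + g y) (y + g y)) _ x := hr.inner ℝ hr
    have h2 : (fun y ↦ inner ℝ (y + g y) (y + g y)) =ᶠ[𝓝 x] fun _ ↦ (1 : ℝ) := by
      filter_upwards [isOpen_ball.mem_nhds hx] with y hy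
      rw [real_inner_self_eq_norm_sq, hret y (by simpa using (mem_ball.1 hy).le), one_pow]
    have h3 := (h1.congr_of_eventuallyEq h2.symm).unique (hasFDerivAt_const (1 : ℝ) x)
    have hsurj : Function.Surjective (1 + fderiv ℝ g x : V →L[ℝ] V) := by
      have : IsUnit (LinearMap.det ((1 + fderiv ℝ g x : V →L[ℝ] V) : V →ₗ[ℝ] V)) :=
        isUnit_iff_ne_zero.2 hdet
      intro w
      obtain ⟨v, hv⟩ := (LinearMap.equivOfIsUnitDet this).surjective w
      exact ⟨v, by simpa using hv⟩
    obtain ⟨w, hw⟩ := hsurj (x + g x)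
    have h4 := DFunLike.congr_fun h3 w
    simp only [ContinuousLinearMap.comp_apply, ContinuousLinearMap.prod_apply,
      fderivInnerCLM_apply, hw, _root_.zero_apply,
      real_inner_self_eq_norm_sq, hret x hxn] at h4
    norm_num at h4
  rw [setIntegral_congr_fun measurableSet_ball hdet0] at key
  simp only [integral_zero] at key
  have : 0 < (volume : Measure V).real (ball 0 1) := by
    rw [measureReal_def]
    exact ENNReal.toReal_pos (measure_ball_pos _ _ one_pos).ne' measure_ball_lt_top.ne
  exact this.ne key

/-- Brouwer's fixed point theorem for the unit ball. -/
theorem exists_fixedPoint_unitBall {f : V → V} (hf : ContinuousOn f (closedBall 0 1))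
    (hmaps : MapsTo f (closedBall 0 1) (closedBall 0 1)) : ∃ x ∈ closedBall (0 : V) 1, f x = x := by
  -- The radial retraction extends `f` to all of `V`, where it can be approximated by smooth maps.
  let ρ : V → V := fun y ↦ (max 1 ‖y‖)⁻¹ • y
  have hpos : ∀ y : V, 0 < max 1 ‖y‖ := fun y ↦ lt_max_of_lt_left one_pos
  have hρ : Continuous ρ :=
    ((continuous_const.max continuous_norm).inv₀ fun y ↦ (hpos y).ne').smul continuous_id
  have hρball : ∀ y, ρ y ∈ closedBall (0 : V) 1 := by
    intro y
    rw [mem_closedBall_zero_iff, norm_smul, norm_inv, Real.norm_of_nonneg (hpos y).le,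
      inv_mul_le_one₀ (hpos y)]
    exact le_max_right _ _
  have hρid : ∀ y ∈ closedBall (0 : V) 1, ρ y = y := by
    intro y hy
    simp [ρ, max_eq_left (mem_closedBall_zero_iff.1 hy)]
  let F : V → V := fun y ↦ f (ρ y)
  have hF : Continuous F := hf.comp_continuous hρ hρball
  have hF1 : ∀ y, ‖F y‖ ≤ 1 := fun y ↦ mem_closedBall_zero_iff.1 (hmaps (hρball y))
  by_contra! hne
  have hcpt : IsCompact (closedBall (0 : V) 1) := isCompact_closedBall _ _
  obtain ⟨x₀, hx₀, hmin⟩ := hcpt.exists_isMinOn (nonempty_closedBall.2 zero_le_one)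
    (hF.sub continuous_id).norm.continuousOn
  -- A third of the least displacement: smoothing `F` and rescaling by `(1 + δ)⁻¹` to preserve the
  -- ball cost at most `δ` each, so a fixed point of the result is displaced by less than `3 * δ`.
  set δ := ‖F x₀ - x₀‖ / 3 with hδ
  have hδpos : 0 < δ := by
    have : F x₀ ≠ x₀ := by
      simp only [F]
      rw [hρid x₀ hx₀]
      exact hne x₀ hx₀
    have := norm_pos_iff.2 (sub_ne_zero.2 this)
    positivity
  obtain ⟨p, hp, hpF, -⟩ := hF.exists_contDiff_approx 1 (ε := fun _ ↦ δ) continuous_const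
    fun _ ↦ hδpos
  have hpn : ∀ x, ‖p x‖ ≤ 1 + δ := by
    intro x
    have h1 := (hpF x).le
    rw [dist_eq_norm] at h1
    calc ‖p x‖ = ‖F x + (p x - F x)‖ := by congr 1; abel
      _ ≤ ‖F x‖ + ‖p x - F x‖ := norm_add_le _ _
      _ ≤ 1 + δ := add_le_add (hF1 x) h1
  have h1δ : 0 < 1 + δ := by positivity
  obtain ⟨x, hx, hfix⟩ := exists_fixedPoint_of_contDiff (f := fun x ↦ (1 + δ)⁻¹ • p x)
    (contDiff_const.smul (by exact_mod_cast hp)) (fun x _ ↦ by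
      rw [norm_smul, norm_inv, Real.norm_of_nonneg h1δ.le, inv_mul_le_one₀ h1δ]
      exact hpn x)
  have h2 : p x = (1 + δ) • x := by
    conv_rhs => rw [← hfix]
    rw [smul_smul, mul_inv_cancel₀ h1δ.ne', one_smul]
  have h3 : ‖F x - x‖ < 2 * δ + δ := by
    have h4 := hpF x
    rw [dist_comm, dist_eq_norm] at h4
    calc ‖F x - x‖ = ‖(F x - p x) + δ • x‖ := by rw [h2]; congr 1; module
      _ ≤ ‖F x - p x‖ + ‖δ • x‖ := norm_add_le _ _
      _ < δ + δ * 1 := by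
        rw [norm_smul, Real.norm_of_nonneg hδpos.le]
        exact add_lt_add_of_lt_of_le h4 (mul_le_mul_of_nonneg_left hx hδpos.le)
      _ ≤ 2 * δ + δ := by linarith
  have h5 : ‖F x₀ - x₀‖ ≤ ‖F x - x‖ := hmin (mem_closedBall_zero_iff.2 hx)
  linarith

/-- A continuous perturbation of the identity of a ball, small compared with the radius,
vanishes somewhere in the ball. -/
theorem exists_zero_of_norm_sub_le {f : V → V} {r : ℝ} (hr : 0 < r)
    (hf : ContinuousOn f (closedBall 0 r)) (hclose : ∀ x ∈ closedBall (0 : V) r, ‖x - f x‖ ≤ r) :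
    ∃ x ∈ closedBall (0 : V) r, f x = 0 := by
  have hmaps : MapsTo (fun x : V ↦ r • x) (closedBall 0 1) (closedBall 0 r) := by
    intro x hx
    rw [mem_closedBall_zero_iff] at hx ⊢
    rw [norm_smul, Real.norm_of_nonneg hr.le]
    nlinarith
  obtain ⟨x, hx, hfix⟩ := exists_fixedPoint_unitBall
    (f := fun x : V ↦ r⁻¹ • (r • x - f (r • x)))
    (((continuous_const_smul r).continuousOn.sub
      (hf.comp (continuous_const_smul r).continuousOn hmaps)).const_smul r⁻¹)
    (fun x hx ↦ by
      rw [mem_closedBall_zero_iff, norm_smul, norm_inv, Real.norm_of_nonneg hr.le,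
        inv_mul_le_one₀ hr]
      exact hclose _ (hmaps hx))
  refine ⟨r • x, hmaps hx, ?_⟩
  have : r • x - f (r • x) = r • x := by
    conv_rhs => rw [← hfix]
    rw [smul_smul, mul_inv_cancel₀ hr.ne', one_smul]
  simpa using this

end Brouwer

end

noncomputable section

/-! ### Smoothness of superposition operators -/

section Superposition

universe u

variable {K : Type*} [TopologicalSpace K]

/-- The operator is pinned down only on functions with values in `Ω`. Elsewhere it takes the default
value `0` if the composition is not continuous, which is harmless since regularity is claimed only
over `Ω`. -/
theorem exists_superposition {E F : Type*} [TopologicalSpace E] [TopologicalSpace F] [Zero F]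
    {Ω : Set E} {G : E → F} (hG : ContinuousOn G Ω) :
    ∃ N : C(K, E) → C(K, F), ∀ u : C(K, E), (∀ t, u t ∈ Ω) → ∀ t, N u t = G (u t) := by
  classical
  refine ⟨fun u ↦ if h : Continuous (fun t ↦ G (u t)) then ⟨_, h⟩ else 0, fun u hu t ↦ ?_⟩
  have h : Continuous fun t ↦ G (u t) := hG.comp_continuous u.continuous hu
  simp only [dif_pos h]
  rfl

variable [CompactSpace K]

/-- Pointwise application of a continuous family of operators to a continuous function. -/
def pointwiseApply (K : Type*) [TopologicalSpace K] [CompactSpace K]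
    (E F : Type*) [NormedAddCommGroup E] [NormedSpace ℝ E]
    [NormedAddCommGroup F] [NormedSpace ℝ F] :
    C(K, E →L[ℝ] F) →L[ℝ] C(K, E) →L[ℝ] C(K, F) :=
  LinearMap.mkContinuous₂
    (LinearMap.mk₂ ℝ (fun (A : C(K, E →L[ℝ] F)) (u : C(K, E)) ↦
        (⟨fun t ↦ A t (u t), by fun_prop⟩ : C(K, F)))
      (fun A B u ↦ by ext; simp) (fun c A u ↦ by ext; simp)
      (fun A u v ↦ by ext; simp) (fun c A u ↦ by ext; simp)) 1
    (fun A u ↦ by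
      rw [one_mul]
      refine (ContinuousMap.norm_le _ (by positivity)).2 fun t ↦ ?_
      exact (A t).le_of_opNorm_le_of_le (A.norm_coe_le_norm t) (u.norm_coe_le_norm t))

@[simp]
theorem pointwiseApply_apply {E F : Type*} [NormedAddCommGroup E] [NormedSpace ℝ E]
    [NormedAddCommGroup F] [NormedSpace ℝ F] (A : C(K, E →L[ℝ] F)) (u : C(K, E)) (t : K) :
    pointwiseApply K E F A u t = A t (u t) := rfl

theorem contDiff_pointwiseApply {E F : Type*} [NormedAddCommGroup E] [NormedSpace ℝ E]
    [NormedAddCommGroup F] [NormedSpace ℝ F] {n : WithTop ℕ∞} :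
    ContDiff ℝ n (fun A : C(K, E →L[ℝ] F) ↦ pointwiseApply K E F A) := by
  fun_prop

/-- Compactness of `K` makes the continuity of `H` uniform along the range of `u`; no local
compactness of `E` is involved. -/
theorem exists_forall_dist_lt_of_continuousOn {E X : Type*} [NormedAddCommGroup E]
    [PseudoMetricSpace X] {Ω : Set E} (hΩ : IsOpen Ω) {H : E → X} (hH : ContinuousOn H Ω)
    (u : C(K, E)) (hu : ∀ t, u t ∈ Ω) {ε : ℝ} (hε : 0 < ε) :
    ∃ δ > 0, ∀ t, ∀ y, dist y (u t) < δ → y ∈ Ω ∧ dist (H y) (H (u t)) < ε := by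
  have key : ∀ᶠ h : E in 𝓝 0, ∀ t ∈ (univ : Set K),
      u t + h ∈ Ω ∧ dist (H (u t + h)) (H (u t)) < ε := by
    refine isCompact_univ.eventually_forall_of_forall_eventually fun t _ ↦ ?_
    have h1 : ContinuousAt H (u t) := hH.continuousAt (hΩ.mem_nhds (hu t))
    have h2 : Tendsto (fun z : E × K ↦ u z.2 + z.1) (𝓝 (0, t)) (𝓝 (u t)) := by
      have : Continuous (fun z : E × K ↦ u z.2 + z.1) := by fun_prop
      simpa using this.tendsto ((0 : E), t)
    have h3 : Tendsto (fun z : E × K ↦ u z.2) (𝓝 (0, t)) (𝓝 (u t)) := by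
      have : Continuous (fun z : E × K ↦ u z.2) := by fun_prop
      simpa using this.tendsto ((0 : E), t)
    have h4 := (h1.tendsto.comp h2).dist (h1.tendsto.comp h3)
    rw [dist_self] at h4
    exact (h2.eventually (hΩ.mem_nhds (hu t))).and (h4.eventually (gt_mem_nhds hε))
  obtain ⟨δ, hδ, H'⟩ := Metric.eventually_nhds_iff.1 key
  refine ⟨δ, hδ, fun t y hy ↦ ?_⟩
  have := H' (y := y - u t) (by rwa [dist_zero_right, ← dist_eq_norm]) t (mem_univ _)
  simpa using this

theorem isOpen_setOf_forall_apply_mem {E : Type*} [TopologicalSpace E] {Ω : Set E}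
    (hΩ : IsOpen Ω) : IsOpen {u : C(K, E) | ∀ t, u t ∈ Ω} := by
  have := ContinuousMap.isOpen_setOfPred_mapsTo (X := K) isCompact_univ hΩ
  simpa [MapsTo] using this

/-- The mean value inequality on a ball about each `u t`, of radius independent of `t`, bounds the
remainder in the sup norm. -/
theorem hasFDerivAt_superposition {E F : Type*} [NormedAddCommGroup E] [NormedSpace ℝ E]
    [NormedAddCommGroup F] [NormedSpace ℝ F] {Ω : Set E} (hΩ : IsOpen Ω) {G : E → F}
    {G' : E → E →L[ℝ] F} (hG : ∀ y ∈ Ω, HasFDerivAt G (G' y) y) (hG' : ContinuousOn G' Ω)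
    {N : C(K, E) → C(K, F)} (hN : ∀ u : C(K, E), (∀ t, u t ∈ Ω) → ∀ t, N u t = G (u t))
    (u : C(K, E)) (hu : ∀ t, u t ∈ Ω) (A : C(K, E →L[ℝ] F)) (hA : ∀ t, A t = G' (u t)) :
    HasFDerivAt N (pointwiseApply K E F A) u := by
  rw [hasFDerivAt_iff_isLittleO_nhds_zero, Asymptotics.isLittleO_iff]
  intro ε hε
  obtain ⟨δ, hδ, H⟩ := exists_forall_dist_lt_of_continuousOn hΩ hG' u hu hε
  filter_upwards [Metric.ball_mem_nhds 0 hδ] with h hh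
  rw [mem_ball_zero_iff] at hh
  have hin : ∀ t, dist (u t + h t) (u t) < δ := fun t ↦ by
    simpa using (h.norm_coe_le_norm t).trans_lt hh
  rw [ContinuousMap.norm_le _ (by positivity)]
  intro t
  have h1 := (convex_ball (u t) δ).norm_image_sub_le_of_norm_hasFDerivWithin_le' (f := G)
    (f' := G') (φ := G' (u t)) (C := ε)
    (fun y hy ↦ (hG y (H t y hy).1).hasFDerivWithinAt)
    (fun y hy ↦ by rw [← dist_eq_norm]; exact (H t y hy).2.le)
    (Metric.mem_ball_self hδ) (Metric.mem_ball.2 (hin t))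
  simp only [ContinuousMap.sub_apply, pointwiseApply_apply]
  rw [hN _ hu, hN (u + h) (fun s ↦ (H s _ (hin s)).1), hA]
  simp only [add_sub_cancel_left] at h1
  exact h1.trans (mul_le_mul_of_nonneg_left (h.norm_coe_le_norm t) hε.le)

/-- Induction on `n`: the derivative is again a superposition operator, that of `fderiv ℝ G`,
followed by a continuous linear map. The target becomes `E →L[ℝ] F`, so `F` is quantified inside the
induction and shares the universe of `E`. -/
theorem contDiffOn_superposition_nat {E : Type u} [NormedAddCommGroup E] [NormedSpace ℝ E]
    {Ω : Set E} (hΩ : IsOpen Ω) (n : ℕ) : ∀ {F : Type u} [NormedAddCommGroup F] [NormedSpace ℝ F]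
    {G : E → F} (_ : ContDiffOn ℝ n G Ω) {N : C(K, E) → C(K, F)}
    (_ : ∀ u : C(K, E), (∀ t, u t ∈ Ω) → ∀ t, N u t = G (u t)),
    ContDiffOn ℝ n N {u | ∀ t, u t ∈ Ω} := by
  induction n with
  | zero =>
    intro F _ _ G hG N hN
    rw [Nat.cast_zero, contDiffOn_zero] at hG ⊢
    intro u hu
    refine ContinuousAt.continuousWithinAt (Metric.continuousAt_iff.2 fun ε hε ↦ ?_)
    obtain ⟨δ, hδ, H⟩ := exists_forall_dist_lt_of_continuousOn hΩ hG u hu hε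
    refine ⟨δ, hδ, fun v hv ↦ ?_⟩
    have hv' : ∀ t, dist (v t) (u t) < δ := fun t ↦
      (ContinuousMap.dist_apply_le_dist t).trans_lt hv
    rw [ContinuousMap.dist_lt_iff hε]
    intro t
    rw [hN v (fun s ↦ (H s _ (hv' s)).1), hN u hu]
    exact (H t _ (hv' t)).2
  | succ n ih =>
    intro F _ _ G hG N hN
    have hV : IsOpen {u : C(K, E) | ∀ t, u t ∈ Ω} := isOpen_setOf_forall_apply_mem hΩ
    have hG0 : ContDiffOn ℝ ((n : WithTop ℕ∞) + 1) G Ω := by exact_mod_cast hG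
    have hG1 := (contDiffOn_succ_iff_fderiv_of_isOpen hΩ).1 hG0
    obtain ⟨N', hN'⟩ := exists_superposition (K := K) hG1.2.2.continuousOn
    have : ContDiffOn ℝ ((n : WithTop ℕ∞) + 1) N {u | ∀ t, u t ∈ Ω} := by
      rw [contDiffOn_succ_iff_hasFDerivWithinAt_of_uniqueDiffOn hV.uniqueDiffOn]
      refine ⟨by simp, fun u ↦ pointwiseApply K E F (N' u),
        contDiff_pointwiseApply.comp_contDiffOn (ih hG1.2.2 hN'), fun u hu ↦ ?_⟩
      exact (hasFDerivAt_superposition hΩ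
        (fun y hy ↦ (hG1.1.differentiableAt (hΩ.mem_nhds hy)).hasFDerivAt)
        hG1.2.2.continuousOn hN u hu _ (hN' u hu)).hasFDerivWithinAt
    exact_mod_cast this

theorem contDiffOn_superposition {E F : Type u} [NormedAddCommGroup E] [NormedSpace ℝ E]
    [NormedAddCommGroup F] [NormedSpace ℝ F] {Ω : Set E} (hΩ : IsOpen Ω) {G : E → F}
    (hG : ContDiffOn ℝ ∞ G Ω) {N : C(K, E) → C(K, F)}
    (hN : ∀ u : C(K, E), (∀ t, u t ∈ Ω) → ∀ t, N u t = G (u t)) :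
    ContDiffOn ℝ ∞ N {u | ∀ t, u t ∈ Ω} := by
  rw [contDiffOn_infty] at hG ⊢
  exact fun n ↦ contDiffOn_superposition_nat hΩ n (hG n) hN

end Superposition

/-! ### The inverse function theorem for smooth maps -/

/-- The source is cut down to the open set where the derivative is invertible, which makes the
inverse smooth on the whole target and not only at the image of `a`. -/
theorem ContDiffOn.exists_openPartialHomeomorph {X Y : Type*} [NormedAddCommGroup X]
    [NormedSpace ℝ X] [CompleteSpace X] [NormedAddCommGroup Y] [NormedSpace ℝ Y]
    {f : X → Y} {V : Set X}
    (hf : ContDiffOn ℝ ∞ f V) (hV : IsOpen V) {a : X} (ha : a ∈ V) {f' : X ≃L[ℝ] Y}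
    (hf' : HasFDerivAt f (f' : X →L[ℝ] Y) a) :
    ∃ e : OpenPartialHomeomorph X Y, a ∈ e.source ∧ e.source ⊆ V ∧ (∀ x, e x = f x) ∧
      ContDiffOn ℝ ∞ e.symm e.target := by
  have hfa : ContDiffAt ℝ ∞ f a := hf.contDiffAt (hV.mem_nhds ha)
  let e₀ := hfa.toOpenPartialHomeomorph f hf' (by simp)
  let V' := V ∩ fderiv ℝ f ⁻¹' range ((↑) : (X ≃L[ℝ] Y) → X →L[ℝ] Y)
  have hV' : IsOpen V' := (hf.continuousOn_fderiv_of_isOpen hV (by simp)).isOpen_inter_preimage hV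
    ContinuousLinearEquiv.isOpen
  have ha' : a ∈ V' := ⟨ha, f', hf'.fderiv.symm⟩
  have hsrc : (e₀.restrOpen V' hV').source = e₀.source ∩ V' := e₀.restrOpen_source V' hV'
  refine ⟨e₀.restrOpen V' hV', ?_, ?_, fun x ↦ ?_, fun y hy ↦ ?_⟩
  · rw [hsrc]
    exact ⟨ContDiffAt.mem_toOpenPartialHomeomorph_source hfa hf' (by simp), ha'⟩
  · rw [hsrc]
    exact fun x hx ↦ hx.2.1
  · rfl
  · have hx := (e₀.restrOpen V' hV').map_target hy
    rw [hsrc] at hx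
    obtain ⟨g', hg'⟩ := hx.2.2
    refine (OpenPartialHomeomorph.contDiffAt_symm _ hy (f₀' := g') ?_ ?_).contDiffWithinAt
    · rw [hg']
      exact ((hf.contDiffAt (hV.mem_nhds hx.2.1)).differentiableAt (by simp)).hasFDerivAt
    · exact hf.contDiffAt (hV.mem_nhds hx.2.1)

/-! ### Solutions of the geodesic equation in a chart -/

section GeodesicEquation

open MeasureTheory intervalIntegral

universe u

variable {E : Type u} [NormedAddCommGroup E] [NormedSpace ℝ E]

/-- The primitive vanishing at `0` of a continuous function on `[-1, 2]`. -/
def primitiveCLM (E : Type u) [NormedAddCommGroup E] [NormedSpace ℝ E] :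
    C(Icc (-1 : ℝ) 2, E) →L[ℝ] C(Icc (-1 : ℝ) 2, E) :=
  have hle : (-1 : ℝ) ≤ 2 := by norm_num
  have hcont : ∀ u : C(Icc (-1 : ℝ) 2, E), Continuous (IccExtend hle u) :=
    fun u ↦ u.continuous.Icc_extend'
  LinearMap.mkContinuous
    { toFun := fun u ↦ ⟨fun t ↦ ∫ s in (0 : ℝ)..t, IccExtend hle u s,
        (continuous_primitive (fun a b ↦ (hcont u).intervalIntegrable a b) 0).comp
          continuous_subtype_val⟩
      map_add' := fun u v ↦ by
        ext t
        exact integral_add ((hcont u).intervalIntegrable _ _) ((hcont v).intervalIntegrable _ _)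
      map_smul' := fun c u ↦ by
        ext t
        exact integral_smul c (IccExtend hle u) } 2
    (fun u ↦ by
      rw [ContinuousMap.norm_le _ (by positivity)]
      rintro ⟨t, ht⟩
      have h1 : ‖∫ s in (0 : ℝ)..t, IccExtend hle u s‖ ≤ ‖u‖ * |t - 0| :=
        norm_integral_le_of_norm_le_const fun s _ ↦ u.norm_coe_le_norm _
      have h2 : |t - 0| ≤ 2 := by rw [sub_zero, abs_le]; constructor <;> linarith [ht.1, ht.2]
      calc _ ≤ ‖u‖ * |t - 0| := h1
        _ ≤ ‖u‖ * 2 := mul_le_mul_of_nonneg_left h2 (norm_nonneg _)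
        _ = 2 * ‖u‖ := mul_comm _ _)

theorem primitiveCLM_apply (u : C(Icc (-1 : ℝ) 2, E)) (t : Icc (-1 : ℝ) 2) :
    primitiveCLM E u t = ∫ s in (0 : ℝ)..t, IccExtend (by norm_num : (-1 : ℝ) ≤ 2) u s := rfl

theorem primitiveCLM_zero_time (u : C(Icc (-1 : ℝ) 2, E)) :
    primitiveCLM E u ⟨0, by norm_num, by norm_num⟩ = 0 := by
  rw [primitiveCLM_apply, integral_same]

theorem hasDerivAt_primitiveCLM [CompleteSpace E] (u : C(Icc (-1 : ℝ) 2, E)) {t : ℝ}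
    (ht : t ∈ Ioo (-1 : ℝ) 2) :
    HasDerivAt (IccExtend (by norm_num : (-1 : ℝ) ≤ 2) (primitiveCLM E u))
      (IccExtend (by norm_num : (-1 : ℝ) ≤ 2) u t) t := by
  have hcont : Continuous (IccExtend (by norm_num : (-1 : ℝ) ≤ 2) u) := u.continuous.Icc_extend'
  have h1 := integral_hasDerivAt_right (hcont.intervalIntegrable 0 t)
    hcont.aestronglyMeasurable.stronglyMeasurableAtFilter hcont.continuousAt
  refine h1.congr_of_eventuallyEq ?_
  filter_upwards [isOpen_Ioo.mem_nhds ht] with s hs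
  rw [IccExtend_of_mem _ _ (Ioo_subset_Icc_self hs), primitiveCLM_apply]

/-- The solutions of the geodesic equation `y'' = -Γ_y(y', y')` with `y(0) = y₀` and small initial
velocity exist on `(-1, 2)`, and their values at time `1` define a local diffeomorphism. -/
theorem exists_local_exponential [CompleteSpace E] {Ω : Set E} (hΩ : IsOpen Ω)
    {Γ : E → E →L[ℝ] E →L[ℝ] E} (hΓ : ContDiffOn ℝ ∞ Γ Ω) {y₀ : E} (hy₀ : y₀ ∈ Ω) :
    ∃ e : OpenPartialHomeomorph E E, 0 ∈ e.source ∧ e 0 = y₀ ∧ e.target ⊆ Ω ∧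
      ContDiffOn ℝ ∞ e e.source ∧ ContDiffOn ℝ ∞ e.symm e.target ∧
      HasFDerivAt e (ContinuousLinearMap.id ℝ E) 0 ∧
      ∀ v ∈ e.source, ∃ y w : ℝ → E, y 0 = y₀ ∧ w 0 = v ∧ y 1 = e v ∧
        ∀ t ∈ Ioo (-1 : ℝ) 2, y t ∈ Ω ∧ HasDerivAt y (w t) t ∧
          HasDerivAt w (-Γ (y t) (w t) (w t)) t := by
  -- Any compact interval with `[0, 1]` in its interior would do.
  set K := Icc (-1 : ℝ) 2
  have hle : (-1 : ℝ) ≤ 2 := by norm_num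
  let I := primitiveCLM E
  let cst : E →L[ℝ] C(K, E) := ContinuousLinearMap.const ℝ K
  -- The unknown is the velocity `u`, the position being its primitive. The geodesic equation with
  -- initial velocity `v` becomes `u + I (N u) = cst v`, that is, `Ψ u = cst v` below.
  let pos : C(K, E) → C(K, E) := fun u ↦ cst y₀ + I u
  have hpos : ContDiff ℝ ∞ pos := contDiff_const.add I.contDiff
  have hposc : Continuous pos := hpos.continuous
  obtain ⟨N₀, hN₀⟩ := exists_superposition (K := K) hΓ.continuousOn
  have hN₀s := contDiffOn_superposition (K := K) hΩ hΓ hN₀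
  let V : Set (C(K, E)) := {u | ∀ t, pos u t ∈ Ω}
  have hV : IsOpen V := (isOpen_setOf_forall_apply_mem hΩ).preimage hposc
  have hV0 : (0 : C(K, E)) ∈ V := fun t ↦ by simpa [pos, cst] using hy₀
  let N : C(K, E) → C(K, E) := fun u ↦
    pointwiseApply K E E (pointwiseApply K E (E →L[ℝ] E) (N₀ (pos u)) u) u
  have hN : ContDiffOn ℝ ∞ N V := by
    have h1 : ContDiffOn ℝ ∞ (fun u ↦ N₀ (pos u)) V :=
      hN₀s.comp hpos.contDiffOn fun u hu ↦ hu
    have h2 := (contDiff_pointwiseApply.comp_contDiffOn h1).clm_apply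
      (contDiffOn_id)
    exact (contDiff_pointwiseApply.comp_contDiffOn h2).clm_apply contDiffOn_id
  -- `N u` carries two explicit factors `u`, so its derivative at `0` vanishes and that of `Ψ` is
  -- the identity.
  have hN0 : HasFDerivAt N (0 : C(K, E) →L[ℝ] C(K, E)) 0 := by
    have h1 : DifferentiableAt ℝ (fun u ↦ pointwiseApply K E E
        (pointwiseApply K E (E →L[ℝ] E) (N₀ (pos u)) u)) 0 := by
      have h1 : ContDiffOn ℝ ∞ (fun u ↦ N₀ (pos u)) V :=
        hN₀s.comp hpos.contDiffOn fun u hu ↦ hu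
      have h2 := (contDiff_pointwiseApply.comp_contDiffOn h1).clm_apply
        (contDiffOn_id)
      exact ((contDiff_pointwiseApply.comp_contDiffOn h2).contDiffAt
        (hV.mem_nhds hV0)).differentiableAt (by simp)
    have h2 := h1.hasFDerivAt.clm_apply (hasFDerivAt_id (0 : C(K, E)))
    refine h2.congr_fderiv ?_
    ext u t
    simp
  let Ψ : C(K, E) → C(K, E) := fun u ↦ u + I (N u)
  have hΨ : ContDiffOn ℝ ∞ Ψ V := contDiffOn_id.add (I.contDiff.comp_contDiffOn hN)
  have hΨ0 : HasFDerivAt Ψ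
      ((ContinuousLinearEquiv.refl ℝ C(K, E) : C(K, E) ≃L[ℝ] C(K, E)) : C(K, E) →L[ℝ] C(K, E))
      0 := by
    refine ((hasFDerivAt_id (0 : C(K, E))).add (I.hasFDerivAt.comp 0 hN0)).congr_fderiv ?_
    ext; simp
  have hΨz : Ψ 0 = 0 := by simp [Ψ, N]
  obtain ⟨R, hR0, hRV, hRΨ, hRs⟩ := hΨ.exists_openPartialHomeomorph hV hV0 hΨ0
  have hR0t : (0 : C(K, E)) ∈ R.target := by
    have := R.map_source hR0
    rwa [hRΨ, hΨz] at this
  have hRsymm0 : R.symm 0 = 0 := by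
    have := R.left_inv hR0
    rwa [hRΨ, hΨz] at this
  have hRd : HasFDerivAt R.symm (ContinuousLinearMap.id ℝ C(K, E)) 0 := by
    have := R.hasFDerivAt_symm hR0t (f' := ContinuousLinearEquiv.refl ℝ C(K, E))
      (by rw [hRsymm0]; exact hΨ0.congr_of_eventuallyEq (Eventually.of_forall hRΨ))
    exact this
  have h1K : (1 : ℝ) ∈ K := ⟨by norm_num, by norm_num⟩
  have h0K : (0 : ℝ) ∈ K := ⟨by norm_num, by norm_num⟩
  let ev : C(K, E) →L[ℝ] E := ContinuousMap.evalCLM ℝ ⟨1, h1K⟩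
  let f : E → E := fun v ↦ y₀ + ev (I (R.symm (cst v)))
  let B : Set E := cst ⁻¹' R.target
  have hB : IsOpen B := R.open_target.preimage cst.continuous
  have hB0 : (0 : E) ∈ B := by simpa [B] using hR0t
  have hf : ContDiffOn ℝ ∞ f B :=
    contDiffOn_const.add ((ev.comp I).contDiff.comp_contDiffOn
      (hRs.comp cst.contDiff.contDiffOn fun v hv ↦ hv))
  have hconst : ∀ v, ev (I (cst v)) = v := by
    intro v
    change primitiveCLM E (cst v) ⟨1, h1K⟩ = v
    rw [primitiveCLM_apply]
    have : ∀ s, IccExtend hle (cst v) s = v := fun s ↦ rfl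
    simp [this]
  have hf0 : f 0 = y₀ := by simp [f, hRsymm0]
  have hfd : HasFDerivAt f (ContinuousLinearMap.id ℝ E) 0 := by
    have h1 : HasFDerivAt (fun v ↦ R.symm (cst v))
        ((ContinuousLinearMap.id ℝ C(K, E)).comp cst) 0 :=
      HasFDerivAt.comp (0 : E) (by simpa using hRd) cst.hasFDerivAt
    refine (((ev.comp I).hasFDerivAt.comp 0 h1).const_add y₀).congr_fderiv ?_
    ext v
    exact hconst v
  -- The extra restriction forces the target of the resulting local inverse into `Ω`.
  have hf' : ContDiffOn ℝ ∞ f (B ∩ f ⁻¹' Ω) := hf.mono inter_subset_left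
  obtain ⟨e, he0, heB, hef, hes⟩ := hf'.exists_openPartialHomeomorph
    (hf.continuousOn.isOpen_inter_preimage hB hΩ) (a := 0) ⟨hB0, by simpa [hf0] using hy₀⟩
    (f' := ContinuousLinearEquiv.refl ℝ E) hfd
  have hefun : (e : E → E) = f := funext hef
  refine ⟨e, he0, by rw [hef, hf0], ?_, ?_, hes, ?_, ?_⟩
  · rintro z hz
    have h1 := heB (e.map_target hz)
    have h2 : f (e.symm z) ∈ Ω := h1.2
    rwa [← hef, e.right_inv hz] at h2
  · rw [hefun]; exact hf'.mono heB
  · rw [hefun]; exact hfd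
  · intro v hv
    have hvB : cst v ∈ R.target := (heB hv).1
    set u := R.symm (cst v) with hu
    have huV : u ∈ V := hRV (R.map_target hvB)
    have hΨu : u + I (N u) = cst v := by
      have := R.right_inv hvB
      rwa [hRΨ] at this
    have hueq : ∀ t, u t = v - I (N u) t := by
      intro t
      have := DFunLike.congr_fun hΨu t
      exact eq_sub_of_add_eq this
    have hNu : ∀ t, N u t = Γ (pos u t) (u t) (u t) := by
      intro t
      change N₀ (pos u) t (u t) (u t) = _
      rw [hN₀ (pos u) huV]
    refine ⟨fun t ↦ y₀ + IccExtend hle (I u) t, IccExtend hle u, ?_, ?_, ?_, ?_⟩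
    · change y₀ + IccExtend hle (I u) 0 = y₀
      rw [IccExtend_of_mem _ _ h0K]
      simp [I, primitiveCLM_zero_time]
    · rw [IccExtend_of_mem _ _ h0K, hueq]
      simp [I, primitiveCLM_zero_time]
    · change y₀ + IccExtend hle (I u) 1 = e v
      rw [IccExtend_of_mem _ _ h1K, hef]
      rfl
    · intro t ht
      have htK : t ∈ K := Ioo_subset_Icc_self ht
      have hy : y₀ + IccExtend hle (I u) t = pos u ⟨t, htK⟩ := by
        rw [IccExtend_of_mem _ _ htK]; rfl
      refine ⟨?_, (hasDerivAt_primitiveCLM u ht).const_add y₀, ?_⟩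
      · change y₀ + IccExtend hle (I u) t ∈ Ω
        rw [hy]
        exact huV _
      · change HasDerivAt _ (-Γ (y₀ + IccExtend hle (I u) t) (IccExtend hle u t)
          (IccExtend hle u t)) t
        rw [hy]
        have h1 := (hasDerivAt_primitiveCLM (N u) ht).const_sub v
        rw [IccExtend_of_mem _ (N u) htK, hNu] at h1
        rw [IccExtend_of_mem _ u htK]
        refine h1.congr_of_eventuallyEq (Eventually.of_forall fun s ↦ ?_)
        exact hueq _

end GeodesicEquation

end

noncomputable section

/-! ### The geodesic field in a chart -/

section GeodesicField

variable {E : Type*} [NormedAddCommGroup E] [NormedSpace ℝ E]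
  {M : Type*} [TopologicalSpace M] [ChartedSpace E M] [IsManifold 𝓘(ℝ, E) ∞ M]

/-- Required for uniqueness of integral curves in `TM`. Points of one fibre are separated in a
trivialization, points of different fibres by their projections. -/
instance tangentBundle_t2Space [T2Space M] : T2Space (TangentBundle 𝓘(ℝ, E) M) := by
  refine ⟨fun p q hpq ↦ ?_⟩
  by_cases hproj : p.proj = q.proj
  · set s := trivializationAt E (TangentSpace 𝓘(ℝ, E) : M → Type _) p.proj
    have hp : p ∈ s.source := FiberBundle.mem_trivializationAt_proj_source
    have hq : q ∈ s.source := by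
      rw [s.mem_source, ← hproj]
      exact FiberBundle.mem_baseSet_trivializationAt' p.proj
    obtain ⟨u, v, hu, hv, hpu, hqv, huv⟩ := t2_separation
      (fun h ↦ hpq (s.toOpenPartialHomeomorph.injOn hp hq h) : s p ≠ s q)
    refine ⟨s.source ∩ s ⁻¹' u, s.source ∩ s ⁻¹' v,
      s.toOpenPartialHomeomorph.isOpen_inter_preimage hu,
      s.toOpenPartialHomeomorph.isOpen_inter_preimage hv, ⟨hp, hpu⟩, ⟨hq, hqv⟩, ?_⟩
    exact (huv.preimage s).mono inter_subset_right inter_subset_right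
  · exact separated_by_continuous (FiberBundle.continuous_proj E (TangentSpace 𝓘(ℝ, E))) hproj

theorem tangentCoord_mk {x₀ y : M} (hy : y ∈ (chartAt E x₀).source) (w : TangentSpace 𝓘(ℝ, E) y) :
    tangentCoord x₀ (⟨y, w⟩ : TangentBundle 𝓘(ℝ, E) M) =
      mfderiv 𝓘(ℝ, E) 𝓘(ℝ, E) (extChartAt 𝓘(ℝ, E) x₀) y w := by
  rw [← TangentBundle.continuousLinearMapAt_trivializationAt hy]
  exact ((trivializationAt E (TangentSpace 𝓘(ℝ, E) : M → Type _)
    x₀).continuousLinearMapAt_apply_of_mem ℝ hy w).symm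

theorem tangentCoord_self (x : M) (w : TangentSpace 𝓘(ℝ, E) x) :
    tangentCoord x (⟨x, w⟩ : TangentBundle 𝓘(ℝ, E) M) = w := by
  rw [tangentCoord_mk (mem_chart_source E x), mfderiv_extChartAt_self]
  rfl

theorem extChartAt_tangent_apply (p e : TangentBundle 𝓘(ℝ, E) M) :
    extChartAt 𝓘(ℝ, E).tangent p e = (extChartAt 𝓘(ℝ, E) p.proj e.proj, tangentCoord p.proj e) :=
  rfl

/-- Expresses the derivative of a chart of `TM` through `projDeriv` and `tangentCoordDeriv`, the
terms in which `local_form` is stated. -/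
theorem hasMFDerivAt_extChartAt_tangent (p e : TangentBundle 𝓘(ℝ, E) M)
    (he : e.proj ∈ (chartAt E p.proj).source) :
    HasMFDerivAt 𝓘(ℝ, E).tangent 𝓘(ℝ, E × E) (extChartAt 𝓘(ℝ, E).tangent p) e
      (((mfderiv 𝓘(ℝ, E) 𝓘(ℝ, E) (extChartAt 𝓘(ℝ, E) p.proj) e.proj :
        TangentSpace 𝓘(ℝ, E) e.proj →L[ℝ] E).comp (projDeriv e) :
          TangentSpace 𝓘(ℝ, E).tangent e →L[ℝ] E).prod (tangentCoordDeriv p.proj e)) := by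
  set s := trivializationAt E (TangentSpace 𝓘(ℝ, E) : M → Type _) p.proj
  have hes : e ∈ s.source := s.mem_source.2 he
  have hsd : MDifferentiableAt 𝓘(ℝ, E).tangent (𝓘(ℝ, E).prod 𝓘(ℝ, E)) s e :=
    ((s.contMDiffOn (n := ∞) (IB := 𝓘(ℝ, E))).contMDiffAt
      (s.open_source.mem_nhds hes)).mdifferentiableAt (by simp)
  have hproj : MDifferentiableAt 𝓘(ℝ, E).tangent 𝓘(ℝ, E)
      (fun u : TangentBundle 𝓘(ℝ, E) M ↦ u.proj) e :=
    (Bundle.contMDiff_proj (n := ∞) (TangentSpace 𝓘(ℝ, E) : M → Type _)).mdifferentiableAt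
      (by simp)
  have hcoord : MDifferentiableAt 𝓘(ℝ, E).tangent 𝓘(ℝ, E) (tangentCoord p.proj) e :=
    mdifferentiableAt_snd.comp e hsd
  have hchart := (mdifferentiableAt_extChartAt (I := 𝓘(ℝ, E)) he).hasMFDerivAt
  have h1 := hchart.comp e hproj.hasMFDerivAt
  exact ⟨h1.1.prodMk hcoord.hasMFDerivAt.1, h1.2.prodMk hcoord.hasMFDerivAt.2⟩

namespace TangentConnection

theorem toFun_geodesicField (P : TangentConnection E M) (v : TangentBundle 𝓘(ℝ, E) M) :
    P.toFun v (P.geodesicField v) = 0 :=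
  (P.existsUnique_geodesicVector v).choose_spec.1.1

theorem projDeriv_geodesicField (P : TangentConnection E M) (v : TangentBundle 𝓘(ℝ, E) M) :
    projDeriv v (P.geodesicField v) = v.2 :=
  (P.existsUnique_geodesicVector v).choose_spec.1.2

theorem eq_geodesicField (P : TangentConnection E M) (v : TangentBundle 𝓘(ℝ, E) M)
    {η : TangentSpace 𝓘(ℝ, E).tangent v} (h0 : P.toFun v η = 0) (h1 : projDeriv v η = v.2) :
    η = P.geodesicField v :=
  (P.existsUnique_geodesicVector v).unique ⟨h0, h1⟩
    ⟨P.toFun_geodesicField v, P.projDeriv_geodesicField v⟩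

/-- In the chart at `x₀` the geodesic field is `(y, w) ↦ (w, -Γ_y(w, w))`. -/
theorem exists_geodesicField_eq (P : TangentConnection E M) (x₀ : M) :
    ∃ Γ : E → E →L[ℝ] E →L[ℝ] E, ContDiffOn ℝ ∞ Γ (extChartAt 𝓘(ℝ, E) x₀).target ∧
      ∀ p e : TangentBundle 𝓘(ℝ, E) M, p.proj = x₀ → e.proj ∈ (chartAt E x₀).source →
        mfderiv 𝓘(ℝ, E).tangent 𝓘(ℝ, E × E) (extChartAt 𝓘(ℝ, E).tangent p) e
          (P.geodesicField e) = (tangentCoord x₀ e,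
            -Γ (extChartAt 𝓘(ℝ, E) x₀ e.proj) (tangentCoord x₀ e) (tangentCoord x₀ e)) := by
  obtain ⟨Γ, hΓ, hloc⟩ := P.local_form x₀
  refine ⟨Γ ∘ (extChartAt 𝓘(ℝ, E) x₀).symm, ?_, ?_⟩
  · rw [← contMDiffOn_iff_contDiffOn]
    refine hΓ.comp (contMDiffOn_extChartAt_symm x₀) fun z hz ↦ ?_
    rw [← extChartAt_source 𝓘(ℝ, E)]
    exact (extChartAt 𝓘(ℝ, E) x₀).map_target hz
  · rintro p e rfl he
    rw [(hasMFDerivAt_extChartAt_tangent p e he).mfderiv]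
    have h1 := hloc e he (P.geodesicField e)
    rw [P.toFun_geodesicField, P.projDeriv_geodesicField, tangentCoord_mk he, map_zero] at h1
    have h2 : tangentCoordDeriv p.proj e (P.geodesicField e) =
        -Γ e.proj (tangentCoord p.proj e) (tangentCoord p.proj e) :=
      eq_neg_of_add_eq_zero_left h1.symm
    have h3 : (extChartAt 𝓘(ℝ, E) p.proj).symm (extChartAt 𝓘(ℝ, E) p.proj e.proj) = e.proj :=
      (extChartAt 𝓘(ℝ, E) p.proj).left_inv (by rwa [extChartAt_source])
    refine Prod.ext ?_ ?_
    · change mfderiv 𝓘(ℝ, E) 𝓘(ℝ, E) (extChartAt 𝓘(ℝ, E) p.proj) e.proj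
        (projDeriv e (P.geodesicField e)) = tangentCoord p.proj e
      rw [P.projDeriv_geodesicField, ← tangentCoord_mk he]
    · change tangentCoordDeriv p.proj e (P.geodesicField e) = -Γ _ _ _
      rw [h2, h3]

/-- Order `1` suffices, since it is used only for uniqueness of integral curves. -/
theorem contMDiff_geodesicField (P : TangentConnection E M) :
    ContMDiff 𝓘(ℝ, E).tangent 𝓘(ℝ, E).tangent.tangent 1
      (fun v ↦ (⟨v, P.geodesicField v⟩ :
        TangentBundle 𝓘(ℝ, E).tangent (TangentBundle 𝓘(ℝ, E) M))) := by
  intro p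
  obtain ⟨Γ, hΓ, hX⟩ := P.exists_geodesicField_eq p.proj
  refine (Bundle.contMDiffAt_section p).2 ?_
  have hopen : IsOpen {e : TangentBundle 𝓘(ℝ, E) M | e.proj ∈ (chartAt E p.proj).source} :=
    (chartAt E p.proj).open_source.preimage (FiberBundle.continuous_proj E _)
  have hev : ∀ᶠ e : TangentBundle 𝓘(ℝ, E) M in 𝓝 p, e.proj ∈ (chartAt E p.proj).source :=
    hopen.mem_nhds (mem_chart_source E p.proj)
  have hψ : ContMDiffAt 𝓘(ℝ, E).tangent 𝓘(ℝ, E × E) 1 (extChartAt 𝓘(ℝ, E).tangent p) p :=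
    contMDiffAt_extChartAt
  have hF : ContDiffAt ℝ 1 (fun z : E × E ↦ (z.2, -Γ z.1 z.2 z.2))
      (extChartAt 𝓘(ℝ, E).tangent p p) := by
    have h1 : ContDiffAt ℝ 1 Γ (extChartAt 𝓘(ℝ, E).tangent p p).1 :=
      (hΓ.contDiffAt ((isOpen_extChartAt_target p.proj).mem_nhds
        (mem_extChartAt_target p.proj))).of_le (by simp)
    have h2 := h1.comp (extChartAt 𝓘(ℝ, E).tangent p p) contDiffAt_fst
    exact contDiffAt_snd.prodMk ((h2.clm_apply contDiffAt_snd).clm_apply contDiffAt_snd).neg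
  refine (hF.contMDiffAt.comp p hψ).congr_of_eventuallyEq ?_
  filter_upwards [hev] with e he
  have hec : e ∈ (chartAt (ModelProd E E) p).source := by simpa using he
  have h1 := TangentBundle.continuousLinearMapAt_trivializationAt (I := 𝓘(ℝ, E).tangent) hec
  have h2 := (trivializationAt (E × E) (TangentSpace 𝓘(ℝ, E).tangent :
    TangentBundle 𝓘(ℝ, E) M → Type _) p).continuousLinearMapAt_apply_of_mem ℝ hec
      (P.geodesicField e)
  rw [h1] at h2
  exact h2.symm.trans (hX p e rfl he)

/-- Turns solutions of the geodesic equation in a chart into integral curves: the derivative of the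
inverse chart takes `(w, -Γ(w, w))` back to the geodesic vector. -/
theorem hasMFDerivAt_symm_of_solution (P : TangentConnection E M) {x : M}
    (p : TangentBundle 𝓘(ℝ, E) M) (hp : p.proj = x)
    {Γ : E → E →L[ℝ] E →L[ℝ] E}
    (hX : ∀ p e : TangentBundle 𝓘(ℝ, E) M, p.proj = x → e.proj ∈ (chartAt E x).source →
        mfderiv 𝓘(ℝ, E).tangent 𝓘(ℝ, E × E) (extChartAt 𝓘(ℝ, E).tangent p) e
          (P.geodesicField e) = (tangentCoord x e,
            -Γ (extChartAt 𝓘(ℝ, E) x e.proj) (tangentCoord x e) (tangentCoord x e)))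
    {y w : ℝ → E} {t : ℝ} (hy : y t ∈ (extChartAt 𝓘(ℝ, E) x).target)
    (hyd : HasDerivAt y (w t) t) (hwd : HasDerivAt w (-Γ (y t) (w t) (w t)) t) :
    HasMFDerivAt 𝓘(ℝ, ℝ) 𝓘(ℝ, E).tangent
      (fun s ↦ (extChartAt 𝓘(ℝ, E).tangent p).symm (y s, w s)) t
      ((1 : ℝ →L[ℝ] ℝ).smulRight
        (P.geodesicField ((extChartAt 𝓘(ℝ, E).tangent p).symm (y t, w t)))) := by
  subst hp
  set ψ := extChartAt 𝓘(ℝ, E).tangent p with hψ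
  have hz : (y t, w t) ∈ ψ.target := by
    rw [hψ, extChartAt_target]
    rw [extChartAt_target] at hy
    refine ⟨?_, by simp⟩
    exact (TangentBundle.mem_chart_target_iff _ _).2 (by simpa using hy)
  set e := ψ.symm (y t, w t) with he
  have hψe : ψ e = (y t, w t) := ψ.right_inv hz
  have hes : e ∈ ψ.source := ψ.map_target hz
  have hep : e.proj ∈ (chartAt E p.proj).source := by
    rw [hψ, extChartAt_source] at hes
    exact (TangentBundle.mem_chart_source_iff _ _).1 hes
  have h1 : tangentCoord p.proj e = w t := congrArg Prod.snd hψe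
  have h2 : extChartAt 𝓘(ℝ, E) p.proj e.proj = y t := congrArg Prod.fst hψe
  have hXe := hX p e rfl hep
  rw [h1, h2] at hXe
  have hrange : range 𝓘(ℝ, E).tangent = univ := ModelWithCorners.range_eq_univ _
  have hsymm := mdifferentiableWithinAt_extChartAt_symm (I := 𝓘(ℝ, E).tangent) hz
  have hcomp := mfderivWithin_extChartAt_symm_comp_mfderiv_extChartAt (I := 𝓘(ℝ, E).tangent) hz
  rw [hrange, mdifferentiableWithinAt_univ] at hsymm
  rw [hrange, mfderivWithin_univ] at hcomp
  have hcurve : HasMFDerivAt 𝓘(ℝ, ℝ) 𝓘(ℝ, E × E) (fun s ↦ (y s, w s)) t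
      ((1 : ℝ →L[ℝ] ℝ).smulRight ((w t, -Γ (y t) (w t) (w t)) : E × E)) :=
    (hyd.prodMk hwd).hasFDerivAt.hasMFDerivAt
  refine (hsymm.hasMFDerivAt.comp t hcurve).congr_mfderiv ?_
  ext
  have h3 := DFunLike.congr_fun hcomp (P.geodesicField e)
  have h4 : mfderiv 𝓘(ℝ, E × E) 𝓘(ℝ, E).tangent ψ.symm (y t, w t)
    ((w t, -Γ (y t) (w t) (w t)) : E × E) = P.geodesicField e := by
    rw [← hXe]; exact h3
  change mfderiv 𝓘(ℝ, E × E) 𝓘(ℝ, E).tangent ψ.symm (y t, w t)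
    ((1 : ℝ) • ((w t, -Γ (y t) (w t) (w t)) : E × E)) = (1 : ℝ) • P.geodesicField e
  rw [one_smul, one_smul, h4]

variable [T2Space M]

theorem eqOn_of_isMIntegralCurveOn (P : TangentConnection E M)
    {c c' : ℝ → TangentBundle 𝓘(ℝ, E) M} {a b t₀ : ℝ} (ht₀ : t₀ ∈ Ioo a b)
    (hc : IsMIntegralCurveOn c P.geodesicField (Ioo a b))
    (hc' : IsMIntegralCurveOn c' P.geodesicField (Ioo a b)) (h : c t₀ = c' t₀) :
    EqOn c c' (Ioo a b) :=
  isMIntegralCurveOn_Ioo_eqOn_of_contMDiff_boundaryless ht₀ P.contMDiff_geodesicField hc hc' h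

/-- Two lifts agree on the intersection of their intervals, which contains `[0, 1]`; hence the lift
chosen in the definition of `exp` does not matter. -/
theorem IsGeodesicLift.exp_eq {P : TangentConnection E M} {v : TangentBundle 𝓘(ℝ, E) M}
    {c : ℝ → TangentBundle 𝓘(ℝ, E) M} (hc : P.IsGeodesicLift v c) : P.exp v = (c 1).proj := by
  have hex : ∃ c, P.IsGeodesicLift v c := ⟨c, hc⟩
  rw [TangentConnection.exp, dif_pos hex]
  obtain ⟨h0, a, b, ha, hb, hint⟩ := hc
  obtain ⟨h0', a', b', ha', hb', hint'⟩ := hex.choose_spec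
  have := P.eqOn_of_isMIntegralCurveOn (a := max a a') (b := min b b') (t₀ := 0)
    ⟨max_lt ha ha', lt_min (by linarith) (by linarith)⟩
    (hint'.mono (Ioo_subset_Ioo (le_max_right _ _) (min_le_right _ _)))
    (hint.mono (Ioo_subset_Ioo (le_max_left _ _) (min_le_left _ _))) (h0'.trans h0.symm)
  rw [this ⟨max_lt (by linarith) (by linarith), lt_min hb hb'⟩]

end TangentConnection

end GeodesicField

end

noncomputable section

/-! ### The exponential map is a local diffeomorphism, equivariant under affine maps -/

section Exponential

variable {E : Type*} [NormedAddCommGroup E] [NormedSpace ℝ E]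
  {M : Type*} [TopologicalSpace M] [ChartedSpace E M] [IsManifold 𝓘(ℝ, E) ∞ M]

namespace TangentConnection

/-- The image vector is horizontal because `f` is affine, and it has the right projection by the
chain rule for `π ∘ df = f ∘ π`. These two properties characterize the geodesic field. -/
theorem IsAffine.mfderiv_tangentMap_geodesicField {P : TangentConnection E M} {f : M → M}
    (hf : P.IsAffine f) (u : TangentBundle 𝓘(ℝ, E) M) :
    mfderiv 𝓘(ℝ, E).tangent 𝓘(ℝ, E).tangent (tangentMap 𝓘(ℝ, E) 𝓘(ℝ, E) f) u
      (P.geodesicField u) = P.geodesicField (tangentMap 𝓘(ℝ, E) 𝓘(ℝ, E) f u) := by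
  have hTf : MDifferentiableAt 𝓘(ℝ, E).tangent 𝓘(ℝ, E).tangent
      (tangentMap 𝓘(ℝ, E) 𝓘(ℝ, E) f) u :=
    (hf.1.contMDiff_tangentMap (m := ∞) (by simp)).mdifferentiable (by simp) u
  refine P.eq_geodesicField _ ?_ ?_
  · have h : (⟨f u.proj, P.toFun (tangentMap 𝓘(ℝ, E) 𝓘(ℝ, E) f u)
        (mfderiv 𝓘(ℝ, E).tangent 𝓘(ℝ, E).tangent (tangentMap 𝓘(ℝ, E) 𝓘(ℝ, E) f) u
          (P.geodesicField u))⟩ : TangentBundle 𝓘(ℝ, E) M) =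
        ⟨f u.proj, mfderiv 𝓘(ℝ, E) 𝓘(ℝ, E) f u.proj (P.toFun u (P.geodesicField u))⟩ :=
      congrFun hf.2 ⟨u, P.geodesicField u⟩
    rw [P.toFun_geodesicField, map_zero] at h
    exact Bundle.TotalSpace.mk_inj.1 h
  · have hproj : ∀ u, MDifferentiableAt 𝓘(ℝ, E).tangent 𝓘(ℝ, E)
        (fun u : TangentBundle 𝓘(ℝ, E) M ↦ u.proj) u := fun u ↦
      (Bundle.contMDiff_proj (n := ∞) (TangentSpace 𝓘(ℝ, E) : M → Type _)).mdifferentiableAt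
        (by simp)
    have hfd : MDifferentiableAt 𝓘(ℝ, E) 𝓘(ℝ, E) f u.proj := hf.1.mdifferentiable (by simp) _
    have h1 := (hproj (tangentMap 𝓘(ℝ, E) 𝓘(ℝ, E) f u)).hasMFDerivAt.comp u hTf.hasMFDerivAt
    have h2 := hfd.hasMFDerivAt.comp u (hproj u).hasMFDerivAt
    have h3 := DFunLike.congr_fun (hasMFDerivAt_unique h1 h2) (P.geodesicField u)
    refine h3.trans ?_
    change mfderiv 𝓘(ℝ, E) 𝓘(ℝ, E) f u.proj (projDeriv u (P.geodesicField u)) = _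
    rw [P.projDeriv_geodesicField]
    rfl

theorem IsGeodesicLift.tangentMap {P : TangentConnection E M} {f : M → M} (hf : P.IsAffine f)
    {v : TangentBundle 𝓘(ℝ, E) M} {c : ℝ → TangentBundle 𝓘(ℝ, E) M} (hc : P.IsGeodesicLift v c) :
    P.IsGeodesicLift (tangentMap 𝓘(ℝ, E) 𝓘(ℝ, E) f v) (tangentMap 𝓘(ℝ, E) 𝓘(ℝ, E) f ∘ c) := by
  obtain ⟨h0, a, b, ha, hb, hint⟩ := hc
  refine ⟨by rw [Function.comp_apply, h0], a, b, ha, hb, fun t ht ↦ ?_⟩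
  have hTf : MDifferentiableAt 𝓘(ℝ, E).tangent 𝓘(ℝ, E).tangent
      (_root_.tangentMap 𝓘(ℝ, E) 𝓘(ℝ, E) f) (c t) :=
    (hf.1.contMDiff_tangentMap (m := ∞) (by simp)).mdifferentiable (by simp) (c t)
  have h1 := hTf.hasMFDerivAt.comp_hasMFDerivWithinAt t (hint t ht)
  refine h1.congr_mfderiv ?_
  ext
  have h2 := hf.mfderiv_tangentMap_geodesicField (c t)
  change mfderiv 𝓘(ℝ, E).tangent 𝓘(ℝ, E).tangent (_root_.tangentMap 𝓘(ℝ, E) 𝓘(ℝ, E) f) (c t)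
    ((1 : ℝ) • P.geodesicField (c t)) = (1 : ℝ) • P.geodesicField _
  rw [one_smul, one_smul, h2]

variable [T2Space M]

theorem IsAffine.exp_tangentMap {P : TangentConnection E M} {f : M → M} (hf : P.IsAffine f)
    {v : TangentBundle 𝓘(ℝ, E) M} (hv : v ∈ P.expDomain) :
    P.exp (tangentMap 𝓘(ℝ, E) 𝓘(ℝ, E) f v) = f (P.exp v) := by
  obtain ⟨c, hc⟩ := hv
  rw [hc.exp_eq, (hc.tangentMap hf).exp_eq]
  rfl

/-- The exponential map at `x` restricts to a diffeomorphism of a neighbourhood of `0` onto an open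
set, with derivative the identity at `0`. -/
theorem exists_partialDiffeomorph_expAt [CompleteSpace E] (P : TangentConnection E M) (x : M) :
    ∃ Φ : PartialDiffeomorph 𝓘(ℝ, E) 𝓘(ℝ, E) E M ∞, 0 ∈ Φ.source ∧ Φ 0 = x ∧
      (∀ v ∈ Φ.source, (⟨x, v⟩ : TangentBundle 𝓘(ℝ, E) M) ∈ P.expDomain ∧ P.expAt x v = Φ v) ∧
      HasMFDerivAt 𝓘(ℝ, E) 𝓘(ℝ, E) Φ 0 (ContinuousLinearMap.id ℝ E) ∧
      HasMFDerivAt 𝓘(ℝ, E) 𝓘(ℝ, E) Φ.invFun x (ContinuousLinearMap.id ℝ E) := by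
  obtain ⟨Γ, hΓ, hX⟩ := P.exists_geodesicField_eq x
  obtain ⟨e, he0, hex, het, hes, hesymm, hed, hsol⟩ := exists_local_exponential
    (isOpen_extChartAt_target x) hΓ (mem_extChartAt_target x)
  set φ := extChartAt 𝓘(ℝ, E) x with hφ
  have hφx : φ.symm (e 0) = x := by rw [hex]; exact extChartAt_to_inv x
  have hopen : IsOpen (φ.source ∩ φ ⁻¹' e.target) :=
    (continuousOn_extChartAt x).isOpen_inter_preimage (isOpen_extChartAt_source x) e.open_target
  let Φ : PartialDiffeomorph 𝓘(ℝ, E) 𝓘(ℝ, E) E M ∞ :=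
    { toFun := φ.symm ∘ e
      invFun := e.symm ∘ φ
      source := e.source
      target := φ.source ∩ φ ⁻¹' e.target
      map_source' := fun v hv ↦ by
        have h1 := e.map_source hv
        refine ⟨φ.map_target (het h1), ?_⟩
        change φ (φ.symm (e v)) ∈ e.target
        rwa [φ.right_inv (het h1)]
      map_target' := fun y hy ↦ e.map_target hy.2
      left_inv' := fun v hv ↦ by
        change e.symm (φ (φ.symm (e v))) = v
        rw [φ.right_inv (het (e.map_source hv)), e.left_inv hv]
      right_inv' := fun y hy ↦ by
        change φ.symm (e (e.symm (φ y))) = y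
        rw [e.right_inv hy.2, φ.left_inv hy.1]
      open_source := e.open_source
      open_target := hopen
      contMDiffOn_toFun := (contMDiffOn_extChartAt_symm x).comp hes.contMDiffOn
        fun v hv ↦ het (e.map_source hv)
      contMDiffOn_invFun := hesymm.contMDiffOn.comp ((contMDiffOn_extChartAt (I := 𝓘(ℝ, E))
        (x := x)).mono (fun y hy ↦ by rw [← extChartAt_source 𝓘(ℝ, E)]; exact hy.1))
          fun y hy ↦ hy.2 }
  refine ⟨Φ, he0, hφx, fun v hv ↦ ?_, ?_, ?_⟩
  · obtain ⟨y, w, hy0, hw0, hy1, hyw⟩ := hsol v hv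
    let p : TangentBundle 𝓘(ℝ, E) M := ⟨x, v⟩
    have hlift : P.IsGeodesicLift p
        (fun s ↦ (extChartAt 𝓘(ℝ, E).tangent p).symm (y s, w s)) := by
      refine ⟨?_, -1, 2, by norm_num, by norm_num, fun t ht ↦ ?_⟩
      · change (extChartAt 𝓘(ℝ, E).tangent p).symm (y 0, w 0) = p
        have : (y 0, w 0) = extChartAt 𝓘(ℝ, E).tangent p p := by
          rw [extChartAt_tangent_apply, hy0, hw0]
          exact Prod.ext rfl (tangentCoord_self x v).symm
        rw [this, extChartAt_to_inv]
      · obtain ⟨h1, h2, h3⟩ := hyw t ht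
        exact (P.hasMFDerivAt_symm_of_solution p rfl hX h1 h2 h3).hasMFDerivWithinAt
    refine ⟨⟨_, hlift⟩, ?_⟩
    change P.exp p = Φ v
    rw [hlift.exp_eq]
    change φ.symm (y 1) = φ.symm (e v)
    rw [hy1]
  · have h1 : HasMFDerivAt 𝓘(ℝ, E) 𝓘(ℝ, E) φ.symm (e 0) (ContinuousLinearMap.id ℝ E) := by
      have h2 := mdifferentiableWithinAt_extChartAt_symm (I := 𝓘(ℝ, E))
        (mem_extChartAt_target (I := 𝓘(ℝ, E)) x)
      have h3 := mfderivWithin_range_extChartAt_symm (I := 𝓘(ℝ, E)) (x := x)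
      rw [ModelWithCorners.range_eq_univ, mdifferentiableWithinAt_univ] at h2
      rw [ModelWithCorners.range_eq_univ, mfderivWithin_univ] at h3
      have h4 := h2.hasMFDerivAt
      rw [h3] at h4
      rw [hex]
      exact h4
    have h2 := h1.comp 0 hed.hasMFDerivAt
    exact h2
  · have h1 : HasMFDerivAt 𝓘(ℝ, E) 𝓘(ℝ, E) φ x (ContinuousLinearMap.id ℝ E) := by
      have h2 := (mdifferentiableAt_extChartAt (I := 𝓘(ℝ, E)) (mem_chart_source E x)).hasMFDerivAt
      rw [mfderiv_extChartAt_self] at h2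
      exact h2
    have h2 : HasFDerivAt e.symm (ContinuousLinearMap.id ℝ E) (φ x) := by
      have hmem : φ x ∈ e.target := by rw [← hex]; exact e.map_source he0
      have h3 : e.symm (φ x) = 0 := by rw [← hex]; exact e.left_inv he0
      exact e.hasFDerivAt_symm hmem (f' := ContinuousLinearEquiv.refl ℝ E) (by rw [h3]; exact hed)
    exact h2.hasMFDerivAt.comp x h1

end TangentConnection

end Exponential

end

noncomputable section

/-! ### Averaging over a compact group -/

section Averaging

open MeasureTheory

variable {E : Type*} [NormedAddCommGroup E] [NormedSpace ℝ E] [CompleteSpace E]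

/-- Each `g ↦ ρ g v` is bounded by compactness, so the uniform boundedness principle applies. -/
theorem exists_forall_opNorm_le {K : Type*} [TopologicalSpace K] [CompactSpace K]
    {ρ : K → E →L[ℝ] E}
    (hcont : Continuous fun z : K × E ↦ ρ z.1 z.2) : ∃ C, 0 < C ∧ ∀ g v, ‖ρ g v‖ ≤ C * ‖v‖ := by
  obtain ⟨C, hC⟩ := banach_steinhaus (g := ρ) fun v ↦ by
    have : Continuous fun g ↦ ρ g v := hcont.comp (by fun_prop : Continuous fun g : K ↦ (g, v))
    obtain ⟨C, hC⟩ := isCompact_univ.exists_bound_of_continuousOn this.continuousOn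
    exact ⟨C, fun g ↦ hC g (mem_univ _)⟩
  exact ⟨max C 1, by positivity, fun g v ↦
    (ρ g).le_of_opNorm_le ((hC g).trans (le_max_left _ _)) v⟩

variable {K : Type*} [Group K] [TopologicalSpace K] [IsTopologicalGroup K] [CompactSpace K]

/-- A finite-dimensional invariant subspace of a representation of a compact group is the range of
an equivariant continuous projection. -/
theorem exists_equivariant_projection {ρ : K → E →L[ℝ] E} (hone : ρ 1 = ContinuousLinearMap.id ℝ E)
    (hmul : ∀ g h, ρ (g * h) = (ρ g).comp (ρ h))
    (hcont : Continuous fun z : K × E ↦ ρ z.1 z.2) (T : Submodule ℝ E) [FiniteDimensional ℝ T]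
    (hT : ∀ g, ∀ v ∈ T, ρ g v ∈ T) :
    ∃ p : E →L[ℝ] E, (∀ v, p v ∈ T) ∧ (∀ v ∈ T, p v = v) ∧ ∀ g v, p (ρ g v) = ρ g (p v) := by
  borelize K
  obtain ⟨C, hC0, hC⟩ := exists_forall_opNorm_le hcont
  obtain ⟨p₀, hp₀⟩ := Submodule.ClosedComplemented.of_finiteDimensional (𝕜 := ℝ) T
  let μ : Measure K := Measure.haarMeasure ⊤
  have hμ : IsProbabilityMeasure μ := ⟨by
    have := Measure.haarMeasure_self (K₀ := (⊤ : TopologicalSpace.PositiveCompacts K))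
    simpa using this⟩
  let q : E →L[ℝ] E := T.subtypeL.comp p₀
  have hqT : ∀ v, q v ∈ T := fun v ↦ (p₀ v).2
  have hqid : ∀ v ∈ T, q v = v := fun v hv ↦ congrArg Subtype.val (hp₀ ⟨v, hv⟩)
  -- The conjugates of `q` are averaged vector by vector, since `ρ` is not assumed continuous in
  -- operator norm.
  let F : E → K → E := fun v h ↦ ρ h (q (ρ h⁻¹ v))
  have hF : ∀ v, Continuous (F v) := by
    intro v
    have h1 : Continuous fun h : K ↦ ρ h⁻¹ v :=
      hcont.comp (by fun_prop : Continuous fun h : K ↦ (h⁻¹, v))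
    exact hcont.comp (continuous_id.prodMk (q.continuous.comp h1))
  have hint : ∀ v, Integrable (F v) μ := fun v ↦
    (hF v).integrable_of_hasCompactSupport (HasCompactSupport.of_compactSpace _)
  have hbound : ∀ v h, ‖F v h‖ ≤ (C * ‖q‖ * C) * ‖v‖ := by
    intro v h
    calc ‖F v h‖ ≤ C * ‖q (ρ h⁻¹ v)‖ := hC _ _
      _ ≤ C * (‖q‖ * (C * ‖v‖)) := by
        gcongr
        exact q.le_of_opNorm_le_of_le le_rfl (hC _ _)
      _ = _ := by ring
  let p : E →L[ℝ] E := LinearMap.mkContinuous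
    { toFun := fun v ↦ ∫ h, F v h ∂μ
      map_add' := fun v w ↦ by
        rw [← integral_add (hint v) (hint w)]
        simp [F]
      map_smul' := fun c v ↦ by
        rw [RingHom.id_apply, ← integral_smul]
        simp [F] } (C * ‖q‖ * C) (fun v ↦ by
      have := norm_integral_le_of_norm_le_const (μ := μ) (Eventually.of_forall (hbound v))
      simpa using this)
  have hp : ∀ v, p v = ∫ h, F v h ∂μ := fun v ↦ rfl
  refine ⟨p, fun v ↦ ?_, fun v hv ↦ ?_, fun g v ↦ ?_⟩
  · exact Convex.integral_mem T.convex T.closed_of_finiteDimensional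
      (Eventually.of_forall fun h ↦ hT h _ (hqT _)) (hint v)
  · have : ∀ h, F v h = v := by
      intro h
      simp only [F]
      rw [hqid _ (hT _ _ hv), ← ContinuousLinearMap.comp_apply, ← hmul, mul_inv_cancel, hone]
      rfl
    simp [hp, this]
  -- Left invariance of Haar measure: substituting `g * h` for `h` moves `ρ g` outside the integral.
  · rw [hp, hp, ← integral_mul_left_eq_self _ g,
      ← ContinuousLinearMap.integral_comp_comm _ (hint v)]
    congr 1
    ext h
    simp only [F]
    rw [hmul, ← ContinuousLinearMap.comp_apply (ρ (g * h)⁻¹), ← hmul (g * h)⁻¹ g, mul_inv_rev,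
      inv_mul_cancel_right]
    rfl

end Averaging

/-! ### The isotropy representation -/

section Isotropy

variable {E : Type*} [NormedAddCommGroup E] [NormedSpace ℝ E]
  {M : Type*} [TopologicalSpace M] [ChartedSpace E M]

/-- Tangent spaces at equal points are identified by the identity of the model space. -/
theorem mfderiv_congr_basepoint {f : M → M} {x y : M} (h : y = x) :
    (mfderiv 𝓘(ℝ, E) 𝓘(ℝ, E) f y : E →L[ℝ] E) = (mfderiv 𝓘(ℝ, E) 𝓘(ℝ, E) f x : E →L[ℝ] E) := by
  subst h; rfl

theorem tangentBundle_mk_congr {x y : M} (h : y = x) (w : E) :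
    (⟨y, w⟩ : TangentBundle 𝓘(ℝ, E) M) = ⟨x, w⟩ := by
  subst h; rfl

theorem eqRec_tangentSpace {x y : M} (h : y = x) (w : TangentSpace 𝓘(ℝ, E) y) :
    (h ▸ w : TangentSpace 𝓘(ℝ, E) x) = (w : E) := by
  subst h; rfl

variable {G : Type*} [Group G] [MulAction G M]

theorem isotropyRep_one (x : M) :
    isotropyRep (E := E) x (1 : MulAction.stabilizer G x) = ContinuousLinearMap.id ℝ E := by
  have : (fun y : M ↦ ((1 : MulAction.stabilizer G x) : G) • y) = id := by
    funext y; simp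
  have h := hasMFDerivAt_id (I := 𝓘(ℝ, E)) x
  rw [← this] at h
  exact h.mfderiv

theorem isotropyRep_mul
    (hsmooth : ∀ g : G, ContMDiff 𝓘(ℝ, E) 𝓘(ℝ, E) ∞ (fun y : M ↦ g • y))
    (x : M) (g h : MulAction.stabilizer G x) :
    isotropyRep (E := E) x (g * h) =
      ((isotropyRep x g : E →L[ℝ] E).comp (isotropyRep x h : E →L[ℝ] E) : E →L[ℝ] E) := by
  have hd : ∀ (g : G) (y : M), MDifferentiableAt 𝓘(ℝ, E) 𝓘(ℝ, E) (fun y : M ↦ g • y) y :=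
    fun g ↦ (hsmooth g).mdifferentiable (by simp)
  have h1 := (hd (g : G) ((h : G) • x)).hasMFDerivAt.comp x (hd (h : G) x).hasMFDerivAt
  have h2 : (fun y : M ↦ (g : G) • y) ∘ (fun y : M ↦ (h : G) • y) =
      fun y ↦ ((g * h : MulAction.stabilizer G x) : G) • y := by
    funext y; simp [mul_smul]
  rw [h2] at h1
  have h3 := mfderiv_congr_basepoint (E := E) (f := fun y : M ↦ (g : G) • y)
    (MulAction.mem_stabilizer_iff.1 h.2)
  refine h1.mfderiv.trans ?_
  exact congrArg (fun A : E →L[ℝ] E ↦ A.comp (isotropyRep x h : E →L[ℝ] E)) h3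

/-- This linearizes the action of the isotropy group. It is `IsAffine.exp_tangentMap` with the base
point `g • x` replaced by `x`. -/
theorem expAt_isotropyRep [IsManifold 𝓘(ℝ, E) ∞ M] [T2Space M] {P : TangentConnection E M}
    (hP : ∀ g : G, P.IsAffine (fun y : M ↦ g • y)) {x : M} (g : MulAction.stabilizer G x)
    {v : TangentSpace 𝓘(ℝ, E) x} (hv : (⟨x, v⟩ : TangentBundle 𝓘(ℝ, E) M) ∈ P.expDomain) :
    P.expAt x (isotropyRep x g v) = (g : G) • P.expAt x v := by
  have h := (hP (g : G)).exp_tangentMap hv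
  refine Eq.trans ?_ h
  exact congrArg P.exp (tangentBundle_mk_congr (MulAction.mem_stabilizer_iff.1 g.2) _).symm

end Isotropy

section OrbitTangent

variable {EG : Type*} [NormedAddCommGroup EG] [NormedSpace ℝ EG]
  {G : Type*} [TopologicalSpace G] [ChartedSpace EG G] [Group G] [LieGroup 𝓘(ℝ, EG) ∞ G]
  {E : Type*} [NormedAddCommGroup E] [NormedSpace ℝ E]
  {M : Type*} [TopologicalSpace M] [ChartedSpace E M] [MulAction G M]

/-- Since `h • g • x = (h * g * h⁻¹) • x`, differentiation at `g = 1` shows that `h` acts on orbit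
directions through conjugation in `G`. -/
theorem isotropyRep_mem_orbitTangentSpace
    (hsmooth : ∀ g : G, ContMDiff 𝓘(ℝ, E) 𝓘(ℝ, E) ∞ (fun y : M ↦ g • y)) {x : M}
    (hx : MDifferentiable 𝓘(ℝ, EG) 𝓘(ℝ, E) (fun g : G ↦ g • x))
    (h : MulAction.stabilizer G x) {v : TangentSpace 𝓘(ℝ, E) x}
    (hv : v ∈ orbitTangentSpace EG G x) : isotropyRep x h v ∈ orbitTangentSpace EG G x := by
  obtain ⟨ξ, rfl⟩ := hv
  let conj : G → G := fun g ↦ h * g * (h : G)⁻¹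
  have hconj : MDifferentiableAt 𝓘(ℝ, EG) 𝓘(ℝ, EG) conj 1 := by
    have : ContMDiff 𝓘(ℝ, EG) 𝓘(ℝ, EG) ∞ conj :=
      (contMDiff_mul_right (a := (h : G)⁻¹)).comp (contMDiff_mul_left (a := (h : G)))
    exact this.mdifferentiable (by simp) 1
  have hconj1 : conj 1 = 1 := by simp [conj]
  have hcomm : (fun g : G ↦ g • x) ∘ conj = (fun y : M ↦ (h : G) • y) ∘ fun g : G ↦ g • x := by
    funext g
    have : (h : G)⁻¹ • x = x := by
      rw [inv_smul_eq_iff]; exact (MulAction.mem_stabilizer_iff.1 h.2).symm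
    simp [conj, mul_smul, this]
  have h1 := (hx (conj 1)).hasMFDerivAt.comp 1 hconj.hasMFDerivAt
  have hd : MDifferentiableAt 𝓘(ℝ, E) 𝓘(ℝ, E) (fun y : M ↦ (h : G) • y) ((1 : G) • x) :=
    (hsmooth h).mdifferentiable (by simp) _
  have h2 := hd.hasMFDerivAt.comp 1 (hx 1).hasMFDerivAt
  rw [hcomm] at h1
  have h3 := DFunLike.congr_fun (hasMFDerivAt_unique h1 h2) ξ
  have h4 : (mfderiv 𝓘(ℝ, E) 𝓘(ℝ, E) (fun y : M ↦ (h : G) • y) ((1 : G) • x) : E →L[ℝ] E) =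
      isotropyRep x h := mfderiv_congr_basepoint (one_smul G x)
  have h5 : ∀ a : G, a = 1 → (mfderiv 𝓘(ℝ, EG) 𝓘(ℝ, E) (fun g : G ↦ g • x) a :
      EG →L[ℝ] E) = mfderiv 𝓘(ℝ, EG) 𝓘(ℝ, E) (fun g : G ↦ g • x) 1 := by
    rintro a rfl; rfl
  refine ⟨mfderiv 𝓘(ℝ, EG) 𝓘(ℝ, EG) conj 1 ξ, ?_⟩
  have h6 := DFunLike.congr_fun (h5 (conj 1) hconj1) (mfderiv 𝓘(ℝ, EG) 𝓘(ℝ, EG) conj 1 ξ)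
  have h7 := DFunLike.congr_fun h4 (mfderiv 𝓘(ℝ, EG) 𝓘(ℝ, E) (fun g : G ↦ g • x) 1 ξ)
  exact h6.symm.trans (h3.trans h7)

end OrbitTangent

end

noncomputable section

/-! ### Continuity of the isotropy representation -/

section Continuity

variable {E : Type*} [NormedAddCommGroup E] [NormedSpace ℝ E]
  {M : Type*} [TopologicalSpace M] [T2Space M] [ChartedSpace E M] [IsManifold 𝓘(ℝ, E) ∞ M]
  {G : Type*} [TopologicalSpace G] [Group G] [MulAction G M] [ContinuousSMul G M]

/-- Near `0` the isotropy representation is the action read in the exponential chart. -/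
theorem exists_isotropyRep_eq_invFun {P : TangentConnection E M}
    (hP : ∀ g : G, P.IsAffine (fun y : M ↦ g • y)) {x : M}
    (hcompact : IsCompact (MulAction.stabilizer G x : Set G))
    (Φ : PartialDiffeomorph 𝓘(ℝ, E) 𝓘(ℝ, E) E M ∞) (h0 : 0 ∈ Φ.source) (hΦ0 : Φ 0 = x)
    (hΦ : ∀ v ∈ Φ.source, (⟨x, v⟩ : TangentBundle 𝓘(ℝ, E) M) ∈ P.expDomain ∧
      P.expAt x v = Φ v) :
    ∃ δ > 0, ∀ v ∈ Metric.ball (0 : E) δ, v ∈ Φ.source ∧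
      ∀ g : MulAction.stabilizer G x, (g : G) • Φ v ∈ Φ.target ∧
        isotropyRep x g v = Φ.invFun ((g : G) • Φ v) := by
  have hxt : x ∈ Φ.target := by rw [← hΦ0]; exact Φ.map_source h0
  have hinv0 : Φ.invFun x = 0 := by rw [← hΦ0]; exact Φ.left_inv h0
  have hcont : ∀ v ∈ Φ.source, ContinuousAt Φ v := fun v hv ↦
    Φ.contMDiffOn_toFun.continuousOn.continuousAt (Φ.open_source.mem_nhds hv)
  have hconti : ∀ y ∈ Φ.target, ContinuousAt Φ.invFun y := fun y hy ↦
    Φ.contMDiffOn_invFun.continuousOn.continuousAt (Φ.open_target.mem_nhds hy)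
  have hev : ∀ᶠ v : E in 𝓝 0, ∀ g ∈ (MulAction.stabilizer G x : Set G), g • Φ v ∈ Φ.target := by
    refine hcompact.eventually_forall_of_forall_eventually fun g hg ↦ ?_
    have h1 : ContinuousAt (fun z : E × G ↦ z.2 • Φ z.1) (0, g) :=
      continuousAt_snd.smul ((hcont 0 h0).comp_of_eq continuousAt_fst rfl)
    refine h1.eventually_mem (Φ.open_target.mem_nhds ?_)
    change g • Φ 0 ∈ Φ.target
    rw [hΦ0, MulAction.mem_stabilizer_iff.1 hg]
    exact hxt
  obtain ⟨δ, hδ, hball⟩ := Metric.mem_nhds_iff.1 (hev.and (Φ.open_source.mem_nhds h0))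
  refine ⟨δ, hδ, fun v hv ↦ ⟨(hball hv).2, fun g ↦ ⟨(hball hv).1 g g.2, ?_⟩⟩⟩
  have htv : ∀ t ∈ Icc (0 : ℝ) 1, t • v ∈ Metric.ball (0 : E) δ := by
    intro t ht
    rw [mem_ball_zero_iff] at hv ⊢
    rw [norm_smul, Real.norm_of_nonneg ht.1]
    nlinarith [norm_nonneg v, ht.2]
  let ρ : E →L[ℝ] E := isotropyRep x g
  -- Equivariance gives `q t = t • ρ v` only when `t • ρ v` lies in the source, and no bound on `ρ`
  -- uniform in `g` is available yet. So the equality is propagated along the segment from `t = 0`: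
  -- it is a closed condition, and where it holds `t • ρ v = q t` lies in the open source, so it
  -- persists a little further.
  let q : ℝ → E := fun t ↦ Φ.invFun ((g : G) • Φ (t • v))
  have hq : ∀ t ∈ Icc (0 : ℝ) 1, ContinuousAt q t := by
    intro t ht
    have h1 : ContinuousAt (fun t : ℝ ↦ Φ (t • v)) t :=
      (hcont _ (hball (htv t ht)).2).comp_of_eq
        (continuous_id.smul continuous_const).continuousAt rfl
    have h2 : ContinuousAt (fun t : ℝ ↦ (g : G) • Φ (t • v)) t := h1.const_smul (g : G)
    exact (hconti _ ((hball (htv t ht)).1 g g.2)).comp_of_eq h2 rfl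
  have hqmem : ∀ t ∈ Icc (0 : ℝ) 1, q t ∈ Φ.source := fun t ht ↦
    Φ.map_target ((hball (htv t ht)).1 g g.2)
  have hqeq : ∀ t ∈ Icc (0 : ℝ) 1, t • ρ v ∈ Φ.source → q t = t • ρ v := by
    intro t ht hts
    have h1 := hΦ _ (hball (htv t ht)).2
    have h2 := expAt_isotropyRep hP g h1.1
    have h3 : (isotropyRep x g (t • v : E) : E) = t • ρ v := ρ.map_smul t v
    have h4 : Φ (t • ρ v) = (g : G) • Φ (t • v) := by
      rw [← (hΦ _ hts).2, ← h1.2, ← h2]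
      exact congrArg (P.expAt x) h3.symm
    change Φ.invFun ((g : G) • Φ (t • v)) = _
    rw [← h4]
    exact Φ.left_inv hts
  have hsub : Icc (0 : ℝ) 1 ⊆ {t | q t = t • ρ v} := by
    refine IsClosed.Icc_subset_of_forall_mem_nhdsWithin ?_ ?_ ?_
    · have h1 : ContinuousOn (fun t ↦ q t - t • ρ v) (Icc 0 1) := fun t ht ↦
        ((hq t ht).sub (continuous_id.smul continuous_const).continuousAt).continuousWithinAt
      have h2 := h1.preimage_isClosed_of_isClosed isClosed_Icc (isClosed_singleton (x := (0 : E)))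
      convert h2 using 1
      ext t
      simp [sub_eq_zero, and_comm]
    · change Φ.invFun ((g : G) • Φ ((0 : ℝ) • v)) = (0 : ℝ) • ρ v
      rw [zero_smul, zero_smul, hΦ0, MulAction.mem_stabilizer_iff.1 g.2, hinv0]
    · rintro t ⟨ht, ht01⟩
      have ht' : t ∈ Icc (0 : ℝ) 1 := Ico_subset_Icc_self ht01
      have h1 : t • ρ v ∈ Φ.source := by
        rw [← (show q t = t • ρ v from ht)]
        exact hqmem t ht'
      have h2 : ContinuousAt (fun s : ℝ ↦ s • ρ v) t :=
        (continuous_id.smul continuous_const).continuousAt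
      have h3 := nhdsWithin_le_nhds (s := Ioi t) (h2.eventually_mem (Φ.open_source.mem_nhds h1))
      filter_upwards [h3, Ioo_mem_nhdsGT ht01.2] with s hs hs1
      exact hqeq s ⟨ht01.1.trans hs1.1.le, hs1.2.le⟩ hs
  have h1 := hsub (right_mem_Icc.2 zero_le_one)
  have h2 : Φ.invFun ((g : G) • Φ ((1 : ℝ) • v)) = (1 : ℝ) • ρ v := h1
  rw [one_smul, one_smul] at h2
  exact h2.symm

/-- Near `0` the formula in the exponential chart is jointly continuous; linearity, through `ρ g v =
ε⁻¹ • ρ g (ε • v)`, extends this to every `v`. -/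
theorem continuous_isotropyRep {P : TangentConnection E M}
    (hP : ∀ g : G, P.IsAffine (fun y : M ↦ g • y)) {x : M}
    (hcompact : IsCompact (MulAction.stabilizer G x : Set G))
    (Φ : PartialDiffeomorph 𝓘(ℝ, E) 𝓘(ℝ, E) E M ∞) (h0 : 0 ∈ Φ.source) (hΦ0 : Φ 0 = x)
    (hΦ : ∀ v ∈ Φ.source, (⟨x, v⟩ : TangentBundle 𝓘(ℝ, E) M) ∈ P.expDomain ∧
      P.expAt x v = Φ v) :
    Continuous fun z : MulAction.stabilizer G x × E ↦ (isotropyRep x z.1 : E →L[ℝ] E) z.2 := by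
  obtain ⟨δ, hδ, hball⟩ := exists_isotropyRep_eq_invFun hP hcompact Φ h0 hΦ0 hΦ
  have hcont : ∀ v ∈ Φ.source, ContinuousAt Φ v := fun v hv ↦
    Φ.contMDiffOn_toFun.continuousOn.continuousAt (Φ.open_source.mem_nhds hv)
  have hconti : ∀ y ∈ Φ.target, ContinuousAt Φ.invFun y := fun y hy ↦
    Φ.contMDiffOn_invFun.continuousOn.continuousAt (Φ.open_target.mem_nhds hy)
  rw [continuous_iff_continuousAt]
  rintro ⟨g, v⟩
  obtain ⟨ε, hε, hεv⟩ : ∃ ε : ℝ, 0 < ε ∧ ε • v ∈ Metric.ball (0 : E) δ := by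
    have h1 : ContinuousAt (fun s : ℝ ↦ s • v) 0 :=
      (continuous_id.smul continuous_const).continuousAt
    have h2 : ∀ᶠ s : ℝ in 𝓝 0, s • v ∈ Metric.ball (0 : E) δ :=
      h1.eventually_mem (by simpa using Metric.ball_mem_nhds (0 : E) hδ)
    obtain ⟨s, hs, hs0⟩ := ((h2.filter_mono (nhdsWithin_le_nhds (s := Ioi (0 : ℝ)))).and
      self_mem_nhdsWithin).exists
    exact ⟨s, hs0, hs⟩
  have h1 : ContinuousAt (fun z : MulAction.stabilizer G x × E ↦ Φ (ε • z.2)) (g, v) :=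
    (hcont _ (hball _ hεv).1).comp_of_eq (continuousAt_snd.const_smul ε) rfl
  have h2 : ContinuousAt (fun z : MulAction.stabilizer G x × E ↦ (z.1 : G) • Φ (ε • z.2))
      (g, v) := (continuous_subtype_val.continuousAt.comp continuousAt_fst).smul h1
  have h3 : ContinuousAt (fun z : MulAction.stabilizer G x × E ↦
      ε⁻¹ • Φ.invFun ((z.1 : G) • Φ (ε • z.2))) (g, v) :=
    ((hconti _ ((hball _ hεv).2 g).1).comp_of_eq h2 rfl).const_smul ε⁻¹
  refine h3.congr ?_
  have h4 : ContinuousAt (fun z : MulAction.stabilizer G x × E ↦ ε • z.2) (g, v) :=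
    continuousAt_snd.const_smul ε
  filter_upwards [h4.eventually_mem (Metric.isOpen_ball.mem_nhds hεv)] with z hz
  rw [← ((hball _ hz).2 z.1).2]
  have h5 : (isotropyRep x z.1 : E →L[ℝ] E) (ε • z.2) = ε • (isotropyRep x z.1 : E →L[ℝ] E) z.2 :=
    map_smul _ _ _
  change ε⁻¹ • (isotropyRep x z.1 : E →L[ℝ] E) (ε • z.2) = _
  rw [h5, smul_smul, inv_mul_cancel₀ hε.ne', one_smul]

end Continuity

end

noncomputable section

/-! ### The image of a subspace under a local diffeomorphism -/

section Submanifold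

variable {E : Type*} [NormedAddCommGroup E] [NormedSpace ℝ E]
  {M : Type*} [TopologicalSpace M] [ChartedSpace E M]

/-- The restriction of a partial diffeomorphism to an open subset of its source. -/
def PartialDiffeomorph.restrictOpen (Φ : PartialDiffeomorph 𝓘(ℝ, E) 𝓘(ℝ, E) E M ∞)
    {U : Set E} (hU : IsOpen U) (hUs : U ⊆ Φ.source) :
    PartialDiffeomorph 𝓘(ℝ, E) 𝓘(ℝ, E) E M ∞ where
  toFun := Φ
  invFun := Φ.invFun
  source := U
  target := Φ.target ∩ Φ.invFun ⁻¹' U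
  map_source' := fun v hv ↦ ⟨Φ.map_source (hUs hv), by
    have : Φ.invFun (Φ v) = v := Φ.left_inv (hUs hv)
    rwa [mem_preimage, this]⟩
  map_target' := fun _ hy ↦ hy.2
  left_inv' := fun _ hv ↦ Φ.left_inv (hUs hv)
  right_inv' := fun _ hy ↦ Φ.right_inv hy.1
  open_source := hU
  open_target := Φ.contMDiffOn_invFun.continuousOn.isOpen_inter_preimage Φ.open_target hU
  contMDiffOn_toFun := Φ.contMDiffOn_toFun.mono hUs
  contMDiffOn_invFun := Φ.contMDiffOn_invFun.mono inter_subset_left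

theorem isSmoothSubmanifold_image [IsManifold 𝓘(ℝ, E) ∞ M]
    (Φ : PartialDiffeomorph 𝓘(ℝ, E) 𝓘(ℝ, E) E M ∞) {W : Submodule ℝ E}
    (hW : W.ClosedComplemented) : IsSmoothSubmanifold E (Φ '' (Φ.source ∩ W)) := by
  have hsub : Φ '' (Φ.source ∩ W) ⊆ Φ.target := by
    rintro _ ⟨v, hv, rfl⟩
    exact Φ.map_source hv.1
  intro y hy
  refine ⟨Φ.toOpenPartialHomeomorph.symm,
    OpenPartialHomeomorph.mem_maximalAtlas_of_contMDiffOn _ Φ.contMDiffOn_invFun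
      Φ.contMDiffOn_toFun, W, hsub hy, hW, ?_⟩
  change Φ.invFun '' (Φ '' (Φ.source ∩ W) ∩ Φ.target) = Φ.source ∩ (W : Set E)
  rw [inter_eq_left.2 hsub, image_image]
  have : ∀ v ∈ Φ.source ∩ (W : Set E), Φ.invFun (Φ v) = v := fun v hv ↦ Φ.left_inv hv.1
  rw [image_congr this, image_id']

/-- A curve in the image, pulled back by `Φ`, is annihilated by `p`, hence so is its velocity.
Conversely `t ↦ Φ (t • v)` has velocity `v`. -/
theorem tangentVectors_image (Φ : PartialDiffeomorph 𝓘(ℝ, E) 𝓘(ℝ, E) E M ∞)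
    (h0 : 0 ∈ Φ.source) {x : M} (hΦ0 : Φ 0 = x)
    (hd : HasMFDerivAt 𝓘(ℝ, E) 𝓘(ℝ, E) Φ 0 (ContinuousLinearMap.id ℝ E))
    (hdi : HasMFDerivAt 𝓘(ℝ, E) 𝓘(ℝ, E) Φ.invFun x (ContinuousLinearMap.id ℝ E))
    (p : E →L[ℝ] E) :
    tangentVectors (Φ '' (Φ.source ∩ LinearMap.ker p.toLinearMap)) x =
      (LinearMap.ker p.toLinearMap : Set E) := by
  refine Set.ext fun (v : E) ↦ ?_
  constructor
  · rintro ⟨γ, hγS, hγ, h, hv⟩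
    rw [eqRec_tangentSpace] at hv
    let A : ℝ →L[ℝ] E := mfderiv 𝓘(ℝ, ℝ) 𝓘(ℝ, E) γ 0
    have h1 : HasMFDerivAt 𝓘(ℝ, E) 𝓘(ℝ, E) Φ.invFun (γ 0) (ContinuousLinearMap.id ℝ E) := by
      rw [h]; exact hdi
    have h2 : HasFDerivAt (Φ.invFun ∘ γ) A 0 :=
      (h1.comp 0 (hγ.mdifferentiableAt (by simp)).hasMFDerivAt).hasFDerivAt
    have h3 : HasFDerivAt (p ∘ (Φ.invFun ∘ γ)) (p.comp A) 0 := p.hasFDerivAt.comp 0 h2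
    have h4 : (p ∘ (Φ.invFun ∘ γ)) =ᶠ[𝓝 0] fun _ ↦ (0 : E) := by
      filter_upwards [hγS] with t ht
      obtain ⟨w, hw, hwt⟩ := ht
      have h5 : Φ.invFun (Φ w) = w := Φ.left_inv hw.1
      change p (Φ.invFun (γ t)) = 0
      rw [← hwt, h5]
      exact hw.2
    have h5 := (h3.congr_of_eventuallyEq h4.symm).unique (hasFDerivAt_const (0 : E) (0 : ℝ))
    have h6 : A 1 = v := hv
    change p v = 0
    rw [← h6]
    exact DFunLike.congr_fun h5 (1 : ℝ)
  · intro hv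
    have hline : ContMDiff 𝓘(ℝ, ℝ) 𝓘(ℝ, E) ∞ (fun t : ℝ ↦ t • v) :=
      (contDiff_id.smul contDiff_const).contMDiff
    have hΦs : ContMDiffAt 𝓘(ℝ, E) 𝓘(ℝ, E) ∞ Φ ((0 : ℝ) • v) := by
      rw [zero_smul]
      exact Φ.contMDiffOn_toFun.contMDiffAt (Φ.open_source.mem_nhds h0)
    have hd' : HasMFDerivAt 𝓘(ℝ, E) 𝓘(ℝ, E) Φ ((0 : ℝ) • v)
        (ContinuousLinearMap.id ℝ E) := by
      rw [zero_smul]; exact hd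
    have hl : HasFDerivAt (fun t : ℝ ↦ t • v) (ContinuousLinearMap.toSpanSingleton ℝ v) 0 :=
      (ContinuousLinearMap.toSpanSingleton ℝ v).hasFDerivAt
    refine ⟨fun t ↦ Φ (t • v), ?_, hΦs.comp 0 hline.contMDiffAt, ?_, ?_⟩
    · have h1 : ∀ᶠ t : ℝ in 𝓝 0, t • v ∈ Φ.source :=
        hline.continuous.continuousAt.eventually_mem
          (by simpa using Φ.open_source.mem_nhds h0)
      filter_upwards [h1] with t ht
      exact ⟨_, ⟨ht, (LinearMap.ker p.toLinearMap).smul_mem t hv⟩, rfl⟩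
    · change Φ ((0 : ℝ) • v) = x
      rw [zero_smul, hΦ0]
    · rw [eqRec_tangentSpace]
      have h1 := (HasMFDerivAt.comp (f := fun t : ℝ ↦ t • v) 0 hd' hl.hasMFDerivAt).mfderiv
      refine (DFunLike.congr_fun h1 (1 : ℝ)).trans ?_
      change (1 : ℝ) • v = v
      rw [one_smul]

end Submanifold

/-! ### Zeros of perturbations of the identity -/

/-- If `F x` vanishes at `0` with derivative the identity, then the maps `F y`, `y` close to `x`,
have zeros, although they are only continuous. -/
theorem eventually_exists_zero {Y V : Type*} [TopologicalSpace Y] [NormedAddCommGroup V]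
    [InnerProductSpace ℝ V] [FiniteDimensional ℝ V] {F : Y → V → V} {x : Y} (hF0 : F x 0 = 0)
    (hFd : HasFDerivAt (F x) (ContinuousLinearMap.id ℝ V) 0) {Q : Y × V → Prop}
    (hQ : ∀ᶠ ξ in 𝓝 (0 : V), Q (x, ξ)) (hQopen : ∀ z, Q z → ∀ᶠ z' in 𝓝 z, Q z')
    (hF : ∀ z, Q z → ContinuousAt (fun z : Y × V ↦ F z.1 z.2) z) :
    ∀ᶠ y in 𝓝 x, ∃ ξ, Q (y, ξ) ∧ F y ξ = 0 := by
  have hsmall : ∀ᶠ ξ in 𝓝 (0 : V), ‖F x ξ - ξ‖ ≤ (1 / 2 : ℝ) * ‖ξ‖ := by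
    have h1 := (hasFDerivAt_iff_isLittleO_nhds_zero.1 hFd)
    have h2 := Asymptotics.isLittleO_iff.1 h1 (c := 1 / 2) (by norm_num)
    filter_upwards [h2] with ξ hξ
    simpa [hF0] using hξ
  -- On this ball `F x` differs from the identity by at most `r / 2`; the other `r / 2` is left for
  -- replacing `x` by `y`, uniformly by compactness.
  obtain ⟨r, hr, hball⟩ := Metric.nhds_basis_closedBall.mem_iff.1 (hQ.and hsmall)
  have hnear : ∀ᶠ y in 𝓝 x, ∀ ξ ∈ Metric.closedBall (0 : V) r,
      Q (y, ξ) ∧ ‖F x ξ - F y ξ‖ < r / 2 := by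
    refine (isCompact_closedBall _ _).eventually_forall_of_forall_eventually fun ξ hξ ↦ ?_
    have hq := (hball hξ).1
    have h4 := hF _ hq
    have h5 : ContinuousAt (fun z : Y × V ↦ F x z.2) (x, ξ) :=
      h4.comp_of_eq (f := fun z : Y × V ↦ (x, z.2)) (by fun_prop) rfl
    have h6 := (h5.sub h4).norm
    refine (hQopen _ hq).and (h6.eventually (gt_mem_nhds ?_))
    simpa using hr
  filter_upwards [hnear] with y hy
  obtain ⟨ξ, hξ, hzero⟩ := exists_zero_of_norm_sub_le (f := F y) hr
    (fun ξ hξ ↦ ((hF _ (hy ξ hξ).1).comp_of_eq (f := fun ξ : V ↦ (y, ξ)) (by fun_prop)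
      rfl).continuousWithinAt)
    (fun ξ hξ ↦ by
      have h1 := (hball hξ).2
      have h2 := (hy ξ hξ).2
      have h3 : ‖ξ‖ ≤ r := by simpa using hξ
      have h4 : ξ - F y ξ = (F x ξ - F y ξ) - (F x ξ - ξ) := by abel
      rw [h4]
      refine (norm_sub_le _ _).trans ?_
      linarith)
  exact ⟨ξ, (hy ξ hξ).1, hzero⟩

/-! ### The saturation of a slice -/

section Saturation

variable {EG : Type*} [NormedAddCommGroup EG] [NormedSpace ℝ EG]
  {G : Type*} [TopologicalSpace G] [ChartedSpace EG G] [Group G] [LieGroup 𝓘(ℝ, EG) ∞ G]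
  {E : Type*} [NormedAddCommGroup E] [NormedSpace ℝ E]
  {M : Type*} [TopologicalSpace M] [ChartedSpace E M] [MulAction G M] [ContinuousSMul G M]

/-- The derivative of `g ↦ g • x` at `1`, between the model spaces. -/
def orbitDeriv (EG : Type*) [NormedAddCommGroup EG] [NormedSpace ℝ EG]
    (G : Type*) [TopologicalSpace G] [ChartedSpace EG G] [Group G]
    {E : Type*} [NormedAddCommGroup E] [NormedSpace ℝ E]
    {M : Type*} [TopologicalSpace M] [ChartedSpace E M] [MulAction G M] (x : M) : EG →L[ℝ] E :=
  mfderiv 𝓘(ℝ, EG) 𝓘(ℝ, E) (fun g : G ↦ g • x) 1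

/-- A zero `ξ` of `l (Φ⁻¹ (γ ξ • y))` puts `γ ξ • y` in the slice, whence `y = (γ ξ)⁻¹ • (γ ξ • y)`
lies in its saturation. `V` stands for the orbit tangent space and `s` for a section of the orbit
derivative. -/
theorem iUnion_smul_image_ker_mem_nhds {x : M}
    (hx : MDifferentiableAt 𝓘(ℝ, EG) 𝓘(ℝ, E) (fun g : G ↦ g • x) 1)
    (Φ : PartialDiffeomorph 𝓘(ℝ, E) 𝓘(ℝ, E) E M ∞) (h0 : 0 ∈ Φ.source) (hΦ0 : Φ 0 = x)
    (hdi : HasMFDerivAt 𝓘(ℝ, E) 𝓘(ℝ, E) Φ.invFun x (ContinuousLinearMap.id ℝ E))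
    {V : Type*} [NormedAddCommGroup V] [InnerProductSpace ℝ V] [FiniteDimensional ℝ V]
    (s : V →L[ℝ] EG) (l : E →L[ℝ] V) (hls : ∀ ξ, l (orbitDeriv EG G x (s ξ)) = ξ) :
    (⋃ g : G, (fun y : M ↦ g • y) '' (Φ '' (Φ.source ∩ LinearMap.ker l.toLinearMap))) ∈ 𝓝 x := by
  have hxt : x ∈ Φ.target := by rw [← hΦ0]; exact Φ.map_source h0
  have hinv0 : Φ.invFun x = 0 := by rw [← hΦ0]; exact Φ.left_inv h0
  let χ := extChartAt 𝓘(ℝ, EG) (1 : G)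
  let γ : V → G := fun ξ ↦ χ.symm (χ 1 + s ξ)
  let F : M → V → V := fun y ξ ↦ l (Φ.invFun (γ ξ • y))
  let Q : M × V → Prop := fun z ↦ χ 1 + s z.2 ∈ χ.target ∧ γ z.2 • z.1 ∈ Φ.target
  have hγ0 : γ 0 = 1 := by
    simp only [γ, map_zero, add_zero]
    exact extChartAt_to_inv 1
  have hline : HasFDerivAt (fun ξ ↦ χ 1 + s ξ) s 0 := s.hasFDerivAt.const_add (χ 1)
  have hγd : HasMFDerivAt 𝓘(ℝ, V) 𝓘(ℝ, EG) γ 0 s := by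
    have h2 := mdifferentiableWithinAt_extChartAt_symm (I := 𝓘(ℝ, EG))
      (mem_extChartAt_target (I := 𝓘(ℝ, EG)) (1 : G))
    have h3 := mfderivWithin_range_extChartAt_symm (I := 𝓘(ℝ, EG)) (x := (1 : G))
    rw [ModelWithCorners.range_eq_univ, mdifferentiableWithinAt_univ] at h2
    rw [ModelWithCorners.range_eq_univ, mfderivWithin_univ] at h3
    have h4 := h2.hasMFDerivAt
    rw [h3] at h4
    have h5 : HasMFDerivAt 𝓘(ℝ, EG) 𝓘(ℝ, EG) χ.symm (χ 1 + s 0)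
        (ContinuousLinearMap.id ℝ EG) := by
      rw [map_zero, add_zero]; exact h4
    exact h5.comp 0 hline.hasMFDerivAt
  have hFd : HasFDerivAt (F x) (ContinuousLinearMap.id ℝ V) 0 := by
    let D : EG →L[ℝ] E := orbitDeriv EG G x
    let A : V →L[ℝ] E := D.comp s
    have h1 : HasMFDerivAt 𝓘(ℝ, EG) 𝓘(ℝ, E) (fun g : G ↦ g • x) (γ 0) D := by
      rw [hγ0]; exact hx.hasMFDerivAt
    have h2 := h1.comp 0 hγd
    have h3 : HasMFDerivAt 𝓘(ℝ, E) 𝓘(ℝ, E) Φ.invFun (((fun g : G ↦ g • x) ∘ γ) 0)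
        (ContinuousLinearMap.id ℝ E) := by
      rw [Function.comp_apply, hγ0, one_smul]; exact hdi
    have h4 : HasMFDerivAt 𝓘(ℝ, V) 𝓘(ℝ, E) (fun ξ ↦ Φ.invFun (γ ξ • x)) 0 A :=
      h3.comp 0 h2
    have h5 : HasFDerivAt (F x) (l.comp A) 0 :=
      l.hasFDerivAt.comp 0 h4.hasFDerivAt
    exact h5.congr_fderiv (ContinuousLinearMap.ext hls)
  have hF0 : F x 0 = 0 := by
    simp only [F]
    rw [hγ0, one_smul, hinv0, map_zero]
  have hsmul : ∀ z : M × V, χ 1 + s z.2 ∈ χ.target →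
      ContinuousAt (fun z : M × V ↦ γ z.2 • z.1) z := by
    intro z hz
    have h1 : ContinuousAt χ.symm (χ 1 + s z.2) :=
      (continuousOn_extChartAt_symm (1 : G)).continuousAt
        ((isOpen_extChartAt_target (1 : G)).mem_nhds hz)
    have h2 : ContinuousAt (fun z : M × V ↦ χ 1 + s z.2) z := by fun_prop
    exact (h1.comp_of_eq h2 rfl).smul continuousAt_fst
  have hQ : ∀ᶠ ξ in 𝓝 (0 : V), Q (x, ξ) := by
    have h1 : Q (x, 0) := by
      refine ⟨?_, ?_⟩
      · change χ 1 + s 0 ∈ χ.target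
        rw [map_zero, add_zero]
        exact mem_extChartAt_target 1
      · change γ 0 • x ∈ Φ.target
        rwa [hγ0, one_smul]
    have h2 : ContinuousAt (fun ξ : V ↦ γ ξ • x) 0 :=
      (hsmul (x, 0) h1.1).comp_of_eq (f := fun ξ : V ↦ (x, ξ)) (by fun_prop) rfl
    exact (hline.continuousAt.eventually_mem ((isOpen_extChartAt_target 1).mem_nhds h1.1)).and
      (h2.eventually_mem (Φ.open_target.mem_nhds h1.2))
  have hQopen : ∀ z, Q z → ∀ᶠ z' in 𝓝 z, Q z' := by
    intro z hz
    have h2 : ContinuousAt (fun z : M × V ↦ χ 1 + s z.2) z := by fun_prop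
    exact (h2.eventually_mem ((isOpen_extChartAt_target 1).mem_nhds hz.1)).and
      ((hsmul z hz.1).eventually_mem (Φ.open_target.mem_nhds hz.2))
  have hFcont : ∀ z, Q z → ContinuousAt (fun z : M × V ↦ F z.1 z.2) z := by
    intro z hz
    have h1 : ContinuousAt Φ.invFun (γ z.2 • z.1) :=
      Φ.contMDiffOn_invFun.continuousOn.continuousAt (Φ.open_target.mem_nhds hz.2)
    exact l.continuous.continuousAt.comp (h1.comp_of_eq (hsmul z hz.1) rfl)
  filter_upwards [eventually_exists_zero hF0 hFd hQ hQopen hFcont] with y hy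
  obtain ⟨ξ, hξ, hzero⟩ := hy
  exact mem_iUnion.2 ⟨(γ ξ)⁻¹, γ ξ • y, ⟨Φ.invFun (γ ξ • y), ⟨Φ.map_target hξ.2, hzero⟩,
    Φ.right_inv hξ.2⟩, inv_smul_smul _ _⟩

/-- The saturation of a slice-like set is a neighbourhood of the base point. The action is only
differentiable along the orbit of `x`, so that the required group element is found by
Brouwer's theorem instead of the implicit function theorem. -/
theorem iUnion_smul_image_mem_nhds [FiniteDimensional ℝ EG] {x : M}
    (hx : MDifferentiableAt 𝓘(ℝ, EG) 𝓘(ℝ, E) (fun g : G ↦ g • x) 1)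
    (Φ : PartialDiffeomorph 𝓘(ℝ, E) 𝓘(ℝ, E) E M ∞) (h0 : 0 ∈ Φ.source) (hΦ0 : Φ 0 = x)
    (hdi : HasMFDerivAt 𝓘(ℝ, E) 𝓘(ℝ, E) Φ.invFun x (ContinuousLinearMap.id ℝ E))
    (p : E →L[ℝ] E) (hpT : ∀ v, p v ∈ (orbitTangentSpace EG G x : Submodule ℝ E))
    (hpid : ∀ v ∈ (orbitTangentSpace EG G x : Submodule ℝ E), p v = v) :
    (⋃ g : G, (fun y : M ↦ g • y) '' (Φ '' (Φ.source ∩ LinearMap.ker p.toLinearMap))) ∈ 𝓝 x := by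
  let D : EG →L[ℝ] E := orbitDeriv EG G x
  let T : Submodule ℝ E := LinearMap.range D.toLinearMap
  have : FiniteDimensional ℝ T := inferInstance
  -- The norm inherited by `T` need not come from an inner product, which Brouwer's theorem was
  -- proved with.
  let L : T ≃L[ℝ] EuclideanSpace ℝ (Fin (Module.finrank ℝ T)) := toEuclidean
  let pT : E →L[ℝ] T := p.codRestrict T hpT
  obtain ⟨σ, hσ⟩ := D.toLinearMap.rangeRestrict.exists_rightInverse_of_surjective
    (LinearMap.range_rangeRestrict _)
  have hσ' : ∀ w : T, D (σ w) = w := fun w ↦ congrArg Subtype.val (DFunLike.congr_fun hσ w)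
  have key := iUnion_smul_image_ker_mem_nhds hx Φ h0 hΦ0 hdi
    ((LinearMap.toContinuousLinearMap (σ : T →ₗ[ℝ] EG)).comp
      (L.symm : EuclideanSpace ℝ (Fin (Module.finrank ℝ T)) →L[ℝ] T))
    ((L : T →L[ℝ] EuclideanSpace ℝ (Fin (Module.finrank ℝ T))).comp pT)
    (fun ξ ↦ by
      change L (pT (D (σ (L.symm ξ)))) = ξ
      have h6 : pT (L.symm ξ : E) = L.symm ξ := Subtype.ext (hpid _ (L.symm ξ).2)
      rw [hσ', h6, L.apply_symm_apply])
  have hker : LinearMap.ker ((L : T →L[ℝ] EuclideanSpace ℝ (Fin (Module.finrank ℝ T))).comp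
      pT).toLinearMap = LinearMap.ker p.toLinearMap := by
    ext v
    change L (pT v) = 0 ↔ p v = 0
    rw [map_eq_zero_iff L L.injective, Subtype.ext_iff]
    rfl
  rwa [hker] at key

theorem isSlice_image [FiniteDimensional ℝ EG] [IsManifold 𝓘(ℝ, E) ∞ M] {x : M}
    (hsmooth : ∀ g : G, Continuous (fun y : M ↦ g • y))
    (hx : MDifferentiableAt 𝓘(ℝ, EG) 𝓘(ℝ, E) (fun g : G ↦ g • x) 1)
    (Φ : PartialDiffeomorph 𝓘(ℝ, E) 𝓘(ℝ, E) E M ∞) (h0 : 0 ∈ Φ.source) (hΦ0 : Φ 0 = x)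
    (hd : HasMFDerivAt 𝓘(ℝ, E) 𝓘(ℝ, E) Φ 0 (ContinuousLinearMap.id ℝ E))
    (hdi : HasMFDerivAt 𝓘(ℝ, E) 𝓘(ℝ, E) Φ.invFun x (ContinuousLinearMap.id ℝ E))
    (p : E →L[ℝ] E) (hpT : ∀ v, p v ∈ (orbitTangentSpace EG G x : Submodule ℝ E))
    (hpid : ∀ v ∈ (orbitTangentSpace EG G x : Submodule ℝ E), p v = v)
    (hcompl : IsCompl (orbitTangentSpace EG G x : Submodule ℝ E) (LinearMap.ker p.toLinearMap))
    (hinv : ∀ g ∈ MulAction.stabilizer G x,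
      ∀ y ∈ Φ '' (Φ.source ∩ LinearMap.ker p.toLinearMap),
        g • y ∈ Φ '' (Φ.source ∩ LinearMap.ker p.toLinearMap)) :
    IsSlice EG E G x (Φ '' (Φ.source ∩ LinearMap.ker p.toLinearMap)) where
  isSmoothSubmanifold := by
    refine isSmoothSubmanifold_image Φ ?_
    have hmem : ∀ v, v - p v ∈ LinearMap.ker p.toLinearMap := fun v ↦ by
      change p (v - p v) = 0
      rw [map_sub, hpid _ (hpT v), sub_self]
    refine ⟨(ContinuousLinearMap.id ℝ E - p).codRestrict _ hmem, fun v ↦ Subtype.ext ?_⟩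
    have h : p v = 0 := v.2
    change (v : E) - p v = v
    rw [h, sub_zero]
  mem := ⟨0, ⟨h0, Submodule.zero_mem _⟩, hΦ0⟩
  isCompl := ⟨LinearMap.ker p.toLinearMap, (tangentVectors_image Φ h0 hΦ0 hd hdi p).symm,
    p.isClosed_ker, hcompl⟩
  mem_nhdsSet := by
    have hnhds := iUnion_smul_image_mem_nhds hx Φ h0 hΦ0 hdi p hpT hpid
    rw [mem_nhdsSet_iff_forall]
    rintro _ ⟨g, rfl⟩
    -- The saturation is `G`-invariant, so being a neighborhood of `x` transfers to `g • x` by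
    -- translation.
    have h1 : (fun y : M ↦ g⁻¹ • y) ⁻¹' (⋃ g : G, (fun y : M ↦ g • y) ''
        (Φ '' (Φ.source ∩ LinearMap.ker p.toLinearMap))) ∈ 𝓝 (g • x) := by
      refine (hsmooth g⁻¹).continuousAt.preimage_mem_nhds ?_
      simpa using hnhds
    filter_upwards [h1] with y hy
    obtain ⟨h, z, hz, hzy⟩ := mem_iUnion.1 hy
    refine mem_iUnion.2 ⟨g * h, z, hz, ?_⟩
    change (g * h) • z = y
    rw [mul_smul]
    exact (congrArg (g • ·) hzy).trans (smul_inv_smul g y)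
  invariant := hinv

end Saturation

end

/-! ### Existence of the slice -/

theorem theorem3p4
    {EG : Type*} [NormedAddCommGroup EG] [NormedSpace ℝ EG] [FiniteDimensional ℝ EG]
    {G : Type*} [TopologicalSpace G] [ChartedSpace EG G] [Group G] [LieGroup 𝓘(ℝ, EG) ∞ G]
    {E : Type*} [NormedAddCommGroup E] [NormedSpace ℝ E] [CompleteSpace E]
    {M : Type*} [TopologicalSpace M] [T2Space M] [ChartedSpace E M] [IsManifold 𝓘(ℝ, E) ∞ M]
    [MulAction G M] [ContinuousSMul G M]
    (hsmooth : ∀ g : G, ContMDiff 𝓘(ℝ, E) 𝓘(ℝ, E) ∞ (fun y : M ↦ g • y))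
    (x : M) (hx : MDifferentiable 𝓘(ℝ, EG) 𝓘(ℝ, E) (fun g : G ↦ g • x))
    (P : TangentConnection E M) (hP : ∀ g : G, P.IsAffine (fun y : M ↦ g • y))
    (hcompact : IsCompact (MulAction.stabilizer G x : Set G)) :
    ∃ W : Submodule ℝ (TangentSpace 𝓘(ℝ, E) x),
      IsClosed (W : Set (TangentSpace 𝓘(ℝ, E) x)) ∧
      IsCompl (orbitTangentSpace EG G x) W ∧
      (∀ g : MulAction.stabilizer G x, ∀ v ∈ W, isotropyRep x g v ∈ W) ∧
      ∀ O ∈ 𝓝 (0 : TangentSpace 𝓘(ℝ, E) x), ∃ U ⊆ O, IsOpen U ∧ 0 ∈ U ∧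
        (∀ g : MulAction.stabilizer G x, ∀ v ∈ U ∩ W, isotropyRep x g v ∈ U ∩ W) ∧
        (∀ v ∈ U, (⟨x, v⟩ : TangentBundle 𝓘(ℝ, E) M) ∈ P.expDomain) ∧
        (∃ Φ : PartialDiffeomorph 𝓘(ℝ, E) 𝓘(ℝ, E) E M ∞,
          Φ.source = U ∧ EqOn Φ (P.expAt x) U) ∧
        IsSlice EG E G x (P.expAt x '' (U ∩ W)) := by
  have := topologicalGroup_of_lieGroup 𝓘(ℝ, EG) ∞ (G := G)
  have : CompactSpace (MulAction.stabilizer G x) := isCompact_iff_compactSpace.1 hcompact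
  obtain ⟨Φ, h0, hΦ0, hΦ, hd, hdi⟩ := P.exists_partialDiffeomorph_expAt x
  let ρ : MulAction.stabilizer G x → E →L[ℝ] E := isotropyRep x
  have hone : ρ 1 = ContinuousLinearMap.id ℝ E := isotropyRep_one x
  have hmul : ∀ g h, ρ (g * h) = (ρ g).comp (ρ h) := isotropyRep_mul hsmooth x
  have hcont : Continuous fun z : MulAction.stabilizer G x × E ↦ ρ z.1 z.2 :=
    continuous_isotropyRep hP hcompact Φ h0 hΦ0 hΦ
  let T : Submodule ℝ E := orbitTangentSpace EG G x
  have : FiniteDimensional ℝ T :=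
    inferInstanceAs (FiniteDimensional ℝ (LinearMap.range (orbitDeriv EG G x).toLinearMap))
  obtain ⟨p, hpT, hpid, hpρ⟩ := exists_equivariant_projection hone hmul hcont T
    fun g v hv ↦ isotropyRep_mem_orbitTangentSpace hsmooth hx g hv
  obtain ⟨C, hC0, hC⟩ := exists_forall_opNorm_le hcont
  let W : Submodule ℝ E := LinearMap.ker p.toLinearMap
  have hcompl : IsCompl T W := by
    refine ⟨Submodule.disjoint_def.2 fun v hvT hvW ↦ ?_, codisjoint_iff.2 ?_⟩
    · rw [← hpid v hvT]
      exact hvW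
    · refine eq_top_iff.2 fun v _ ↦ Submodule.mem_sup.2 ⟨p v, hpT v, v - p v, ?_, by abel⟩
      change p (v - p v) = 0
      rw [map_sub, hpid _ (hpT v), sub_self]
  have hWinv : ∀ g, ∀ v ∈ W, ρ g v ∈ W := by
    intro g v hv
    have hv' : p v = 0 := hv
    change p (ρ g v) = 0
    rw [hpρ, hv', map_zero]
  refine ⟨W, p.isClosed_ker, hcompl, hWinv, fun O hO ↦ ?_⟩
  obtain ⟨r, hr, hball⟩ := Metric.nhds_basis_ball.mem_iff.1
    (inter_mem (show O ∈ 𝓝 (0 : E) from hO) (Φ.open_source.mem_nhds h0))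
  -- The saturation of a small ball under the isotropy group: open and invariant, while the uniform
  -- bound `C` keeps it inside the ball of radius `r`.
  let U : Set E := ⋃ g, ρ g ⁻¹' Metric.ball 0 (r / C)
  have hUball : U ⊆ Metric.ball 0 r := by
    intro v hv
    obtain ⟨g, hg⟩ := mem_iUnion.1 hv
    have h1 : v = ρ g⁻¹ (ρ g v) := by
      have h2 := hmul g⁻¹ g
      rw [inv_mul_cancel, hone] at h2
      exact DFunLike.congr_fun h2 v
    have h2 : ‖ρ g v‖ < r / C := mem_ball_zero_iff.1 hg
    rw [mem_ball_zero_iff, h1]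
    calc ‖ρ g⁻¹ (ρ g v)‖ ≤ C * ‖ρ g v‖ := hC _ _
      _ < C * (r / C) := by gcongr
      _ = r := by field_simp
  have hUopen : IsOpen U := isOpen_iUnion fun g ↦ Metric.isOpen_ball.preimage (ρ g).continuous
  have h0U : (0 : E) ∈ U := mem_iUnion.2 ⟨1, by
    rw [mem_preimage, map_zero]
    exact Metric.mem_ball_self (by positivity)⟩
  have hUinv : ∀ g, ∀ v ∈ U, ρ g v ∈ U := by
    intro g v hv
    obtain ⟨h, hh⟩ := mem_iUnion.1 hv
    refine mem_iUnion.2 ⟨h * g⁻¹, ?_⟩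
    have h1 := hmul (h * g⁻¹) g
    rw [inv_mul_cancel_right] at h1
    rwa [mem_preimage, ← ContinuousLinearMap.comp_apply, ← h1]
  have hUs : U ⊆ Φ.source := fun v hv ↦ (hball (hUball hv)).2
  let Ψ := Φ.restrictOpen hUopen hUs
  have hΨ : ∀ v ∈ U, P.expAt x v = Ψ v := fun v hv ↦ (hΦ v (hUs hv)).2
  have hslice : IsSlice EG E G x (Ψ '' (Ψ.source ∩ W)) := by
    refine isSlice_image (fun g ↦ (hsmooth g).continuous) (hx 1) Ψ h0U hΦ0 hd hdi p hpT hpid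
      hcompl ?_
    rintro g hg _ ⟨v, ⟨hvU, hvW⟩, rfl⟩
    refine ⟨ρ ⟨g, hg⟩ v, ⟨hUinv _ v hvU, hWinv _ v hvW⟩, ?_⟩
    rw [← hΨ v hvU, ← hΨ _ (hUinv _ v hvU)]
    exact expAt_isotropyRep hP ⟨g, hg⟩ (hΦ v (hUs hvU)).1
  have himage : P.expAt x '' (U ∩ (W : Set E)) = Ψ '' (Ψ.source ∩ W) :=
    image_congr fun v hv ↦ hΨ v hv.1
  refine ⟨U, fun v hv ↦ (hball (hUball hv)).1, hUopen, h0U,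
    fun g v hv ↦ ⟨hUinv g v hv.1, hWinv g v hv.2⟩, fun v hv ↦ (hΦ v (hUs hv)).1,
    ⟨Ψ, rfl, fun v hv ↦ (hΨ v hv).symm⟩, ?_⟩
  exact himage ▸ hslice
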